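/- **Cyclic proof systems.** A derivation system consists of sequents and rules, each rule having a conclusion and a finite list of premises. A preproof is a finite tree labelled by sequents, in which every node carries a rule whose conclusion labels the node and whose premises label its children in order, or is an open leaf (assumption), or is a *bud*: a leaf $t$ with a *companion* $\beta(t)$, an inner node strictly below $t$ with the same label. A preproof morphism $f$ maps sequents to sequents and every rule with conclusion $\Gamma$ and premises $\Delta_1,\dots,\Delta_n$ to a preproof with endsequent $f(\Gamma)$ and assumptions $f(\Delta_1),\dots,f(\Delta_n)$; then $f(\Pi)$ results from $\Pi$ by replacing each rule by its image and reconnecting buds. It is a *proof morphism* if it maps proofs to proofs. **Cyclic Gödel's T ($\mathit{CGT}$).** Types: $A ::= N \mid A\to A$; sequents $\Gamma\Rightarrow A$ with $\Gamma$ a list of types. Rules (premises / conclusion): $\mathrm{Id}$: $/\,A\Rightarrow A$; $0$: $/\Rightarrow N$; $\mathrm S$: $/\,N\Rightarrow N$; $\mathrm L$: $\Gamma\Rightarrow A;\ \Gamma,B\Rightarrow C\,/\,\Gamma,A\to B\Rightarrow C$; $\mathrm R$: $\Gamma,A\Rightarrow B\,/\,\Gamma\Rightarrow A\to B$; $\mathrm{Cond}$: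 $\Gamma\Rightarrow A;\ \Gamma,N\Rightarrow A\,/\,\Gamma,N\Rightarrow A$; $\mathrm{Ex}$: $\Gamma_0,A,B,\Gamma_1\Rightarrow C\,/\,\Gamma_0,B,A,\Gamma_1\Rightarrow C$; $\mathrm{Wk}$: $\Gamma\Rightarrow B\,/\,\Gamma,A\Rightarrow B$; $\mathrm{Ctr}$: $\Gamma,A,A\Rightarrow B\,/\,\Gamma,A\Rightarrow B$; $\mathrm{Cut}$: $\Gamma\Rightarrow B;\ \Gamma,B\Rightarrow A\,/\,\Gamma\Rightarrow A$. Traces follow occurrences of $N$ in contexts from conclusion to premise: each occurrence in an unchanged part of the context is related to itself, $\mathrm{Ex}$ permutes, in $\mathrm{Ctr}$ a contracted $N$ is related to both copies, and in $\mathrm{Cond}$ the last $N$ is related to the last $N$ of the second premise with *progress*; no other pairs are related. A preproof without assumptions is a proof if every infinite branch (passing from buds to companions) carries, from some point on, a trace progressing infinitely often. **The reset system $\mathrm R(\mathit{CGT})$.** Its sequents are $\Gamma\Rightarrow A\,;(\Theta,\sigma)$ with $(\Theta,\sigma)$ a Safra board over $\{0,1\}$ on the set $X$ of occurrences of $N$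 in $\Gamma$: $\Theta$ is a finite linearly ordered set of chips (the control), $\sigma$ assigns to each $(x,a)\in X\times\{0,1\}$ a set of subsets of $\Theta$ (stacks), and every chip lies in some stack. Its rules are the rules of $\mathit{CGT}$, each premise carrying a successor board along the trace relation (move all stacks along the relation, joining progress values; move the stacks that arrive at $(y,1)$ to $(y,0)$ with a new chip on top, one new chip per $y$; delete unused chips), together with the structural rules $\mathrm{Weak}$ (drop stacks), $\mathrm{Pop}$ (add empty stacks at squares $(x,0)$) and $\mathrm{Reset}_\gamma$ (if $\gamma\in\Theta$ is covered, i.e. on top of no stack, remove all chips above $\gamma$ from the stacks containing $\gamma$). A preproof without assumptions is a proof if for every bud $t$ there are a chip $\gamma$ and a word $\theta$ such that all controls from $\beta(t)$ to $t$ begin with $\theta\gamma$ and $\mathrm{Reset}_\gamma$ is applied between $\beta(t)$ and $t$. The morphism $\mathit{strip}:\mathrm R(\mathit{CGT})\to\mathit{CGT}$ forgets the boards and removes the structural rules. **Reset Gödel's T ($\mathit{RGT}$).** Sequents are $\Theta\mid\Gamma\Rightarrow A$ with $\Theta$ a word of distinct letters and $\Gamma$ a list of annotated types $B^u$, $u$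 a subsequence of $\Theta$, and $u=\varepsilon$ unless $B=N$. In a premise, $\Theta'$ is $\Theta$ without the letters not occurring in the context of that premise. Rules: $\mathrm{Id}$: $/\,\Theta\mid A^u\Rightarrow A$; $0$: $/\,\Theta\mid\ \Rightarrow N$; $\mathrm S$: $/\,\Theta\mid N^u\Rightarrow N$; $\mathrm L$: $\Theta'\mid\Gamma\Rightarrow A;\ \Theta\mid\Gamma,B^u\Rightarrow C\,/\,\Theta\mid\Gamma,(A\to B)^u\Rightarrow C$; $\mathrm R$: $\Theta\mid\Gamma,A^\varepsilon\Rightarrow B\,/\,\Theta\mid\Gamma\Rightarrow A\to B$; $\mathrm{Cond}$ ($a\notin\Theta$): $\Theta'\mid\Gamma\Rightarrow A;\ \Theta a\mid\Gamma,N^{ua}\Rightarrow A\,/\,\Theta\mid\Gamma,N^u\Rightarrow A$; $\mathrm{Ex}$: $\Theta\mid\Gamma,A^v,B^u,\Gamma_1\Rightarrow C\,/\,\Theta\mid\Gamma,B^u,A^v,\Gamma_1\Rightarrow C$; $\mathrm{Wk}$: $\Theta'\mid\Gamma\Rightarrow B\,/\,\Theta\mid\Gamma,A^u\Rightarrow B$;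 $\mathrm{Ctr}$: $\Theta\mid\Gamma,A^u,A^u\Rightarrow B\,/\,\Theta\mid\Gamma,A^u\Rightarrow B$; $\mathrm{Cut}$: $\Theta\mid\Gamma\Rightarrow B;\ \Theta\mid\Gamma,B^\varepsilon\Rightarrow A\,/\,\Theta\mid\Gamma\Rightarrow A$; $\mathrm{Reset}_a$: $\Theta'\mid\Gamma,N^{ua},\dots,N^{ua}\Rightarrow B\,/\,\Theta\mid\Gamma,N^{uau_1},\dots,N^{uau_n}\Rightarrow B$, where $n\ge1$, all $u_i\neq\varepsilon$, and $a$ does not occur in $\Gamma$. A preproof without assumptions is a proof under the same condition on buds as in $\mathrm R(\mathit{CGT})$; it is a proof of $\Gamma\Rightarrow A$ if its root is $\varepsilon\mid\Gamma^\varepsilon\Rightarrow A$, all types in $\Gamma^\varepsilon$ being annotated with $\varepsilon$. On sequents let $\mathit{embed}(\Theta\mid\Gamma\Rightarrow A)$ be $\overline\Gamma\Rightarrow A\,;(\overline\Theta,\sigma)$, where $\overline\Gamma$ is $\Gamma$ without annotations, $\overline\Theta$ consists of the letters of $\Theta$ occurring in $\Gamma$, in the order of $\Theta$, and $\sigma(i,0)=\{\{x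 : x \text{ occurs in } u\}\}$ if the $i$-th occurrence of $N$ in $\Gamma$ is $N^u$, $\sigma(i,1)=\emptyset$. **Corollary (Soundness of Reset Gödel's T).** The function $\mathit{embed}$ on sequents extends to a proof morphism $\mathit{embed}:\mathit{RGT}\to\mathrm R(\mathit{CGT})$ that sends each rule to one application of the corresponding rule of $\mathrm R(\mathit{CGT})$, followed by at most one application of $\mathrm{Pop}$ above each premise, and such that the following holds. If $\Pi$ is an $\mathit{RGT}$-proof of $\Gamma\Rightarrow A$, then $\mathit{strip}(\mathit{embed}(\Pi))$ is a $\mathit{CGT}$-proof of $\Gamma\Rightarrow A$, and it has the same computational content as $\Pi$: unfolding both along their back edges, erasing the annotations in $\Pi$ and skipping its applications of $\mathrm{Reset}$, yields the same possibly infinite tree of $\mathit{CGT}$-rules (the same coterm). -/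

import Mathlib

namespace CyclicGT

/-! ### Derivation systems, preproofs, cyclic proof systems and morphisms -/

/-- A derivation system: sequents, rules (rule instances), and for every rule its conclusion and
its finite list of premises. -/
structure DerivSys where
  Seq : Type
  Rule : Type
  concl : Rule → Seq
  prems : Rule → List Seq

/-- Finite trees with back edges, labelled by sequents and rules.
* `hyp Γ` is an open leaf labelled `Γ` (an assumption);
* `bud Γ k` is a bud labelled `Γ`, its companion is its ancestor `k + 1` levels further down
  (`k = 0` is the parent), hence automatically an inner node strictly below the bud;
* `infer R cs` is a node labelled with the conclusion of `R`, at which `R` is applied and which has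
  exactly one child for each premise of `R`. -/
inductive Preproof (D : DerivSys) : Type
  | hyp (Γ : D.Seq) : Preproof D
  | bud (Γ : D.Seq) (k : ℕ) : Preproof D
  | infer (R : D.Rule) (cs : Fin (D.prems R).length → Preproof D) : Preproof D

namespace Preproof

variable {D : DerivSys}

/-- The sequent labelling the root. -/
def endseq : Preproof D → D.Seq
  | hyp Γ => Γ
  | bud Γ _ => Γ
  | infer R _ => D.concl R

/-- The labels of the open leaves, from left to right. -/
def assumptions : Preproof D → List D.Seq
  | hyp Γ => [Γ]
  | bud _ _ => []
  | infer _ cs => (List.ofFn fun i => (cs i).assumptions).flatten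

/-- Correctness of the labelling, relative to the list of labels of the nodes below the root
(nearest first): the children of a node carry the premises of the rule applied there, and each bud
has a companion, carrying the same sequent as the bud. -/
def Correct : Preproof D → List D.Seq → Prop
  | hyp _, _ => True
  | bud Γ k, below => below[k]? = some Γ
  | infer R cs, below =>
      ∀ i, (cs i).endseq = (D.prems R).get i ∧ (cs i).Correct (D.concl R :: below)

/-- The preproofs of the derivation system. -/
def IsPreproof (P : Preproof D) : Prop := P.Correct []

def IsHyp : Preproof D → Prop
  | hyp _ => True
  | _ => False

/-- The part of the tree above a position. Positions are finite sequences of numbers, the `i`-th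
child of the node at `t` having position `t ++ [i]`; the nodes are the positions for which the
value is not `none`. -/
def sub : Preproof D → List ℕ → Option (Preproof D)
  | P, [] => some P
  | infer R cs, i :: t => if h : i < (D.prems R).length then (cs ⟨i, h⟩).sub t else none
  | hyp _, _ :: _ => none
  | bud _ _, _ :: _ => none

/-- The position of the companion of a bud `bud Γ k` at position `t`. -/
def companion (t : List ℕ) (k : ℕ) : List ℕ := t.take (t.length - (k + 1))

/-- `P.Step s t`: the node `t` is a child of `s`, or `s` is a bud with companion `t`. -/
def Step (P : Preproof D) (s t : List ℕ) : Prop :=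
  (∃ R cs i, P.sub s = some (infer R cs) ∧ i < (D.prems R).length ∧ t = s ++ [i]) ∨
  (∃ Γ k, P.sub s = some (bud Γ k) ∧ t = companion s k)

/-- Infinite branches through the preproof. -/
def IsBranch (P : Preproof D) (π : ℕ → List ℕ) : Prop :=
  π 0 = [] ∧ ∀ i, P.Step (π i) (π (i + 1))

/-- Composition of preproofs: replace the `n`-th open leaf (from the left, starting with `0`) by
`g n d`, where `d` is the height of that leaf. The two numerical arguments are the number of open
leaves to the left of the tree and the height of its root. -/
def plug (g : ℕ → ℕ → Preproof D) : Preproof D → ℕ → ℕ → Preproof D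
  | hyp _, n, d => g n d
  | bud Γ k, _, _ => bud Γ k
  | infer R cs, n, d => infer R fun i =>
      (cs i).plug g (n + ((List.ofFn fun j => (cs j).assumptions.length).take i).sum) (d + 1)

end Preproof

/-- A cyclic proof system: a derivation system with a set of preproofs without assumptions. -/
structure CyclicSys extends DerivSys where
  pfs : Set (Preproof toDerivSys)
  isPreproof_of_mem : ∀ P ∈ pfs, P.IsPreproof
  closed_of_mem : ∀ P ∈ pfs, P.assumptions = []

/-- A preproof morphism translates sequents to sequents and each rule to a preproof, whose
endsequent and assumptions are the translations of the conclusion and the premises. -/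
structure PreproofMorphism (D E : DerivSys) where
  onSeq : D.Seq → E.Seq
  onRule : D.Rule → Preproof E
  isPreproof : ∀ R, (onRule R).IsPreproof
  endseq_eq : ∀ R, (onRule R).endseq = onSeq (D.concl R)
  assumptions_eq : ∀ R, (onRule R).assumptions = (D.prems R).map onSeq

namespace PreproofMorphism

variable {D E : DerivSys}

/-- The translation of preproofs, carried out at height `d` of the target; `env` lists the
heights of the roots of the translations of the nodes below (nearest first). Each rule application is
replaced by the preproof assigned to the rule. The open leaf coming from a bud is joined to the
root of the translation of its companion. If that root is not strictly below the leaf (the whole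
cycle has been translated to identity preproofs), there is no inner node it could be joined to and the
leaf stays open. -/
def mapAt (f : PreproofMorphism D E) : Preproof D → List ℕ → ℕ → Preproof E
  | .hyp Γ, _, _ => .hyp (f.onSeq Γ)
  | .bud Γ k, env, d =>
      match env[k]? with
      | some e => if e < d then .bud (f.onSeq Γ) (d - e - 1) else .hyp (f.onSeq Γ)
      | none => .hyp (f.onSeq Γ)
  | .infer R cs, env, d =>
      (f.onRule R).plug
        (fun n d' =>
          if h : n < (D.prems R).length then f.mapAt (cs ⟨n, h⟩) (d :: env) d'
          else .hyp (f.onSeq (D.concl R)))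
        0 d

/-- The preproof `f(P)`. -/
def map (f : PreproofMorphism D E) (P : Preproof D) : Preproof E := f.mapAt P [] 0

/-- A proof morphism is a preproof morphism which maps proofs to proofs. -/
def IsProofMorphism {D E : CyclicSys} (f : PreproofMorphism D.toDerivSys E.toDerivSys) : Prop :=
  ∀ P ∈ D.pfs, f.map P ∈ E.pfs

end PreproofMorphism

/-! ### Activation algebras, trace categories and trace interpretations -/

/-- A finite join-semilattice with least element `⊥` (written `0` in the literature) and an activation
element different from `⊥`. -/
class ActivationAlgebra (A : Type) extends SemilatticeSup A, OrderBot A where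
  act : A
  act_ne_bot : act ≠ ⊥
  finite : Finite A

/-- The booleans `{0, 1}` with activation element `1`. -/
noncomputable instance : ActivationAlgebra Bool where
  act := true
  act_ne_bot := by decide
  finite := inferInstance

/-- The morphisms of the activated trace category are relations of this kind; its objects are taken to
be finite sets of natural numbers. -/
abbrev TraceRel (A : Type) := Set (ℕ × A × ℕ)

section Trace

variable {A : Type} [ActivationAlgebra A]

def TraceRel.id (A : Type) [ActivationAlgebra A] (X : Finset ℕ) : TraceRel A :=
  {p | p.1 ∈ X ∧ p.2.1 = ⊥ ∧ p.2.2 = p.1}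

/-- First `r`, then `s`. -/
def TraceRel.comp (r s : TraceRel A) : TraceRel A :=
  {p | ∃ y a b, (p.1, a, y) ∈ r ∧ (y, b, p.2.2) ∈ s ∧ a ⊔ b = p.2.1}

/-- A path through the trace category, given by its objects and its one-step morphisms. -/
structure TracePath (A : Type) where
  obj : ℕ → Finset ℕ
  step : ℕ → TraceRel A

/-- The composite of `n` steps, starting at index `i`. -/
def TracePath.hom (P : TracePath A) (i : ℕ) : ℕ → TraceRel A
  | 0 => TraceRel.id A (P.obj i)
  | n + 1 => (P.hom i n).comp (P.step (i + n))

/-- The trace condition: along some subpath there is a sequence of elements, consecutive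
elements being related with the activation element. -/
def TracePath.TraceCondition (P : TracePath A) : Prop :=
  ∃ S : ℕ → ℕ, StrictMono S ∧ ∃ x : ℕ → ℕ,
    (∀ i, x i ∈ P.obj (S i)) ∧
    ∀ i, (x i, ActivationAlgebra.act, x (i + 1)) ∈ P.hom (S i) (S (i + 1) - S i)

end Trace

/-- A trace interpretation of a derivation system; `mor R i` is the morphism from the
object of the conclusion to the object of the `i`-th premise (counted from `0`). -/
structure TraceInterp (D : DerivSys) (A : Type) where
  obj : D.Seq → Finset ℕ
  mor : D.Rule → ℕ → TraceRel A
  mor_mem : ∀ R i (hi : i < (D.prems R).length) x a y, (x, a, y) ∈ mor R i →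
    x ∈ obj (D.concl R) ∧ y ∈ obj ((D.prems R)[i])

namespace TraceInterp

variable {D : DerivSys} {A : Type} [ActivationAlgebra A]

/-- The path through the trace category induced by a branch. -/
def path (ι : TraceInterp D A) (P : Preproof D) (π : ℕ → List ℕ) : TracePath A where
  obj i := match P.sub (π i) with
    | some Q => ι.obj Q.endseq
    | none => ∅
  step i := {p |
    (∃ R cs j, P.sub (π i) = some (.infer R cs) ∧ π (i + 1) = π i ++ [j] ∧ p ∈ ι.mor R j) ∨
    (∃ Γ k, P.sub (π i) = some (.bud Γ k) ∧ p ∈ TraceRel.id A (ι.obj Γ))}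

/-- The cyclic proof system given by the global trace condition. -/
def cyclicSys (ι : TraceInterp D A) : CyclicSys where
  toDerivSys := D
  pfs := {P | P.IsPreproof ∧ P.assumptions = [] ∧
    ∀ π, P.IsBranch π → (ι.path P π).TraceCondition}
  isPreproof_of_mem _ h := h.1
  closed_of_mem _ h := h.2.1

end TraceInterp

/-! ### Safra boards -/

/-- The data of a Safra board. Chips are natural numbers; the control is the list of its
chips in increasing order. -/
structure Board (A : Type) where
  ctrl : List ℕ
  stk : ℕ → A → Set (Finset ℕ)

namespace Board

variable {A : Type} [ActivationAlgebra A]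

/-- Safra boards on the finite set `X`. -/
structure IsOn (b : Board A) (X : Finset ℕ) : Prop where
  nodup : b.ctrl.Nodup
  stk_empty : ∀ x, x ∉ X → ∀ a, b.stk x a = ∅
  stack_sub : ∀ x a, ∀ S ∈ b.stk x a, ∀ γ ∈ S, γ ∈ b.ctrl
  occurs : ∀ γ ∈ b.ctrl, ∃ x a, ∃ S ∈ b.stk x a, γ ∈ S

/-- The linear order of the control. -/
def le (b : Board A) (γ δ : ℕ) : Prop := b.ctrl.idxOf γ ≤ b.ctrl.idxOf δ

/-- The chip `γ` of the control is not on top of any stack. -/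
def Covered (b : Board A) (γ : ℕ) : Prop :=
  γ ∈ b.ctrl ∧ ∀ x a, ∀ S ∈ b.stk x a, ¬ (γ ∈ S ∧ ∀ δ ∈ S, b.le δ γ)

/-- The stacks after moving them along `τ`. -/
def moved (b : Board A) (τ : TraceRel A) (y : ℕ) (a : A) : Set (Finset ℕ) :=
  {S | ∃ x c e, S ∈ b.stk x e ∧ (x, c, y) ∈ τ ∧ a = e ⊔ c}

open Classical in
/-- The board `b'` (on `Y`) is a `τ`-successor of `b`: after moving the stacks, each stack at
`(y, act)` is moved to `(y, ⊥)` and gets a new chip `chip y` on top, the same chip for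
all stacks at `(y, act)`. The new chips `new` are put on top of the remaining old control. -/
def IsSuccessor (τ : TraceRel A) (Y : Finset ℕ) (b b' : Board A) : Prop :=
  ∃ (new : List ℕ) (chip : ℕ → ℕ),
    new.Nodup ∧ (∀ γ ∈ new, γ ∉ b.ctrl) ∧
    Set.BijOn chip {y | y ∈ Y ∧ (b.moved τ y ActivationAlgebra.act).Nonempty} {γ | γ ∈ new} ∧
    b'.ctrl = b.ctrl.filter (fun γ => ∃ y ∈ Y, ∃ a, ∃ S ∈ b.moved τ y a, γ ∈ S) ++ new ∧
    ∀ y a, b'.stk y a =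
      if a = ActivationAlgebra.act then ∅
      else if a = ⊥ then
        b.moved τ y ⊥ ∪ {T | ∃ S ∈ b.moved τ y ActivationAlgebra.act, T = insert (chip y) S}
      else b.moved τ y a

def IsWeakening (b b' : Board A) : Prop :=
  (∀ x a, b'.stk x a ⊆ b.stk x a) ∧ b'.ctrl.Sublist b.ctrl

open Classical in
/-- The `γ`-reset of a stack. -/
noncomputable def resetStack (b : Board A) (γ : ℕ) (S : Finset ℕ) : Finset ℕ :=
  if γ ∈ S then S.filter (fun δ => b.le δ γ) else S

open Classical in
/-- The board `b'` is the `γ`-reset of `b`, which requires `γ` to be covered. -/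
def IsReset (γ : ℕ) (b b' : Board A) : Prop :=
  b.Covered γ ∧
  (∀ x a, b'.stk x a = b.resetStack γ '' b.stk x a) ∧
  b'.ctrl = b.ctrl.filter (fun δ => ∃ x a, ∃ S ∈ b'.stk x a, δ ∈ S)

def IsPopulation (b b' : Board A) : Prop :=
  b'.ctrl = b.ctrl ∧
  (∀ x, b.stk x ⊥ ⊆ b'.stk x ⊥ ∧ b'.stk x ⊥ ⊆ b.stk x ⊥ ∪ {∅}) ∧
  ∀ x a, a ≠ ⊥ → b'.stk x a = b.stk x a

end Board

/-! ### Reset proof systems -/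

/-- The local soundness condition of reset systems: for every bud there are a letter `a` and a word `u`
such that all controls between the companion and the bud (inclusive) begin with `u a`, and the
rule `Reset a` is applied between the companion and the bud. -/
def Preproof.HasInvariants {D : DerivSys} (ctrl : D.Seq → List ℕ) (resets : D.Rule → Option ℕ)
    (P : Preproof D) : Prop :=
  ∀ t Γ k, P.sub t = some (.bud Γ k) →
    ∃ u a,
      (∀ s Q, companion t k <+: s → s <+: t → P.sub s = some Q →
        u ++ [a] <+: ctrl Q.endseq) ∧
      ∃ s R cs, companion t k <+: s ∧ s <+: t ∧ P.sub s = some (.infer R cs) ∧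
        resets R = some a

namespace TraceInterp

variable {D : DerivSys} {A : Type} [ActivationAlgebra A]

/-- Sequents annotated with Safra boards on their trace object. -/
structure RSeq (ι : TraceInterp D A) where
  seq : D.Seq
  board : Board A
  isOn : board.IsOn (ι.obj seq)

/-- The rules of the reset system; `c` is the conclusion, `p` and `ps` are the premises. -/
inductive RRule (ι : TraceInterp D A) : Type
  | weak (c p : ι.RSeq) (hs : p.seq = c.seq) (h : c.board.IsWeakening p.board) : RRule ι
  | reset (γ : ℕ) (c p : ι.RSeq) (hs : p.seq = c.seq) (h : c.board.IsReset γ p.board) : RRule ι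
  | pop (c p : ι.RSeq) (hs : p.seq = c.seq) (h : c.board.IsPopulation p.board) : RRule ι
  | lift (R : D.Rule) (c : ι.RSeq) (ps : List ι.RSeq) (hc : c.seq = D.concl R)
      (hps : ps.map RSeq.seq = D.prems R)
      (h : ∀ i (hi : i < ps.length),
        c.board.IsSuccessor (ι.mor R i) (ι.obj ps[i].seq) ps[i].board) : RRule ι

namespace RRule

variable {ι : TraceInterp D A}

def concl : ι.RRule → ι.RSeq
  | weak c _ _ _ => c
  | reset _ c _ _ _ => c
  | pop c _ _ _ => c
  | lift _ c _ _ _ _ => c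

def prems : ι.RRule → List ι.RSeq
  | weak _ p _ _ => [p]
  | reset _ _ p _ _ => [p]
  | pop _ p _ _ => [p]
  | lift _ _ ps _ _ _ => ps

/-- The chip which is reset by the rule, if the rule is a reset. -/
def chip : ι.RRule → Option ℕ
  | reset γ _ _ _ _ => some γ
  | _ => none

/-- The underlying rule, if the rule is not structural. -/
def base : ι.RRule → Option D.Rule
  | lift R _ _ _ _ _ => some R
  | _ => none

def IsPop : ι.RRule → Prop
  | pop _ _ _ _ => True
  | _ => False

end RRule

/-- The reset system of the cyclic proof system induced by `ι`. -/
def resetDeriv (ι : TraceInterp D A) : DerivSys where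
  Seq := ι.RSeq
  Rule := ι.RRule
  concl := RRule.concl
  prems := RRule.prems

def resetSys (ι : TraceInterp D A) : CyclicSys where
  toDerivSys := ι.resetDeriv
  pfs := {P | P.IsPreproof ∧ P.assumptions = [] ∧
    P.HasInvariants (D := ι.resetDeriv) (fun s => (RSeq.board s).ctrl) RRule.chip}
  isPreproof_of_mem _ h := h.1
  closed_of_mem _ h := h.2.1

/-- Structural rules are translated to the identity preproof, the other rules to a
single application of the underlying rule. -/
def stripRule (ι : TraceInterp D A) : ι.RRule → Preproof D
  | .weak c _ _ _ => .hyp c.seq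
  | .reset _ c _ _ _ => .hyp c.seq
  | .pop c _ _ _ => .hyp c.seq
  | .lift R _ _ _ _ _ => .infer R fun i => .hyp ((D.prems R).get i)

/-- The morphism removing the boards. -/
def strip (ι : TraceInterp D A) : PreproofMorphism ι.resetDeriv D where
  onSeq := RSeq.seq
  onRule := ι.stripRule
  isPreproof R := by
    cases R with
    | lift R c ps hc hps h => exact fun i => ⟨rfl, trivial⟩
    | _ => trivial
  endseq_eq R := by
    cases R with
    | lift R c ps hc hps h => exact hc.symm
    | _ => rfl
  assumptions_eq R := by
    cases R with
    | lift R c ps hc hps h =>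
      have h1 : (List.ofFn fun i => [(D.prems R).get i]).flatten = D.prems R := by
        have h2 : (List.ofFn fun i => [(D.prems R).get i]) = (D.prems R).map (fun s => [s]) := by
          apply List.ext_getElem <;> simp
        rw [h2]
        generalize D.prems R = l
        induction l with
        | nil => rfl
        | cons x l ih => simp [ih]
      exact h1.trans hps.symm
    | weak c p hs h => exact congrArg (fun s => [s]) hs.symm
    | reset γ c p hs h => exact congrArg (fun s => [s]) hs.symm
    | pop c p hs h => exact congrArg (fun s => [s]) hs.symm

end TraceInterp

/-! ### Computational content

A preproof is a finite presentation of a possibly infinite term (a coterm): the tree of rules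
obtained by unfolding the preproof along its back edges. Bookkeeping rules, which have no
counterpart among the term-forming rules, are skipped. -/

/-- `P.Reads er t p r`: starting from the node `t` of `P`, jumping from buds to their companions
and passing bookkeeping rules (those with `er R = none`), the position `p` of the coterm is reached and
the rule there is `r`. -/
inductive Preproof.Reads {D : DerivSys} {α : Type} (er : D.Rule → Option α) (P : Preproof D) :
    List ℕ → List ℕ → α → Prop
  | here {t R cs r} : P.sub t = some (.infer R cs) → er R = some r → Reads er P t [] r
  | child {t R cs r i p r'} : P.sub t = some (.infer R cs) → er R = some r →
      Reads er P (t ++ [i]) p r' → Reads er P t (i :: p) r'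
  | skip {t R cs p r'} : P.sub t = some (.infer R cs) → er R = none →
      Reads er P (t ++ [0]) p r' → Reads er P t p r'
  | jump {t Γ k p r'} : P.sub t = some (.bud Γ k) →
      Reads er P (companion t k) p r' → Reads er P t p r'

/-- The coterm denoted by a preproof, as the set of pairs of a position and the rule there. -/
def Preproof.content {D : DerivSys} {α : Type} (er : D.Rule → Option α) (P : Preproof D) :
    Set (List ℕ × α) :=
  {x | P.Reads er [] x.1 x.2}

/-! ### Cyclic Gödel's T -/

inductive Ty : Type
  | N : Ty
  | arr : Ty → Ty → Ty
  deriving DecidableEq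

namespace CGT

/-- Sequents `ctx ⇒ ty`. -/
structure Seq where
  ctx : List Ty
  ty : Ty

inductive Rule : Type
  | id (A : Ty) : Rule
  | zero : Rule
  | succ : Rule
  | left (Γ : List Ty) (A B C : Ty) : Rule
  | right (Γ : List Ty) (A B : Ty) : Rule
  | cond (Γ : List Ty) (A : Ty) : Rule
  | ex (Γ : List Ty) (A B : Ty) (Γ' : List Ty) (C : Ty) : Rule
  | wk (Γ : List Ty) (A B : Ty) : Rule
  | ctr (Γ : List Ty) (A B : Ty) : Rule
  | cut (Γ : List Ty) (B A : Ty) : Rule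

namespace Rule

def concl : Rule → Seq
  | id A => ⟨[A], A⟩
  | zero => ⟨[], .N⟩
  | succ => ⟨[.N], .N⟩
  | left Γ A B C => ⟨Γ ++ [.arr A B], C⟩
  | right Γ A B => ⟨Γ, .arr A B⟩
  | cond Γ A => ⟨Γ ++ [.N], A⟩
  | ex Γ A B Γ' C => ⟨Γ ++ [B, A] ++ Γ', C⟩
  | wk Γ A B => ⟨Γ ++ [A], B⟩
  | ctr Γ A B => ⟨Γ ++ [A], B⟩
  | cut Γ _ A => ⟨Γ, A⟩

def prems : Rule → List Seq
  | id _ => []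
  | zero => []
  | succ => []
  | left Γ A B C => [⟨Γ, A⟩, ⟨Γ ++ [B], C⟩]
  | right Γ A B => [⟨Γ ++ [A], B⟩]
  | cond Γ A => [⟨Γ, A⟩, ⟨Γ ++ [.N], A⟩]
  | ex Γ A B Γ' C => [⟨Γ ++ [A, B] ++ Γ', C⟩]
  | wk Γ _ B => [⟨Γ, B⟩]
  | ctr Γ A B => [⟨Γ ++ [A, A], B⟩]
  | cut Γ B A => [⟨Γ, B⟩, ⟨Γ ++ [B], A⟩]

end Rule

def deriv : DerivSys where
  Seq := Seq
  Rule := Rule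
  concl := Rule.concl
  prems := Rule.prems

/-- The number of occurrences of `N`. -/
def numN (Γ : List Ty) : ℕ := Γ.count .N

/-- The relation `{(j, 0, j) | 1 ≤ j ≤ n}`. -/
def idUpTo (n : ℕ) : TraceRel Bool := {p | 1 ≤ p.1 ∧ p.1 ≤ n ∧ p.2.1 = false ∧ p.2.2 = p.1}

/-- The trace maps; premises are counted from `0`. The objects are `{1, …, numN Γ}`, the
occurrences of `N` being numbered from left to right. -/
def traceMap : Rule → ℕ → TraceRel Bool
  | .ex Γ A B Γ' _, _ =>
      let k := numN Γ
      let n := numN (Γ ++ [B, A] ++ Γ')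
      if A = .N ∧ B = .N then
        {p | p ∈ idUpTo n ∧ (p.1 ≤ k ∨ k + 2 < p.1)} ∪
          {(k + 1, false, k + 2), (k + 2, false, k + 1)}
      else idUpTo n
  | .wk Γ A _, _ => if A = .N then idUpTo (numN (Γ ++ [A]) - 1) else idUpTo (numN (Γ ++ [A]))
  | .cond Γ _, 0 => idUpTo (numN (Γ ++ [.N]) - 1)
  | .cond Γ _, _ + 1 =>
      let k := numN (Γ ++ [.N])
      idUpTo (k - 1) ∪ {(k, true, k)}
  | .ctr Γ A _, _ =>
      let k := numN (Γ ++ [A])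
      if A = .N then idUpTo k ∪ {(k, false, k + 1)} else idUpTo k
  | R, _ => idUpTo (numN R.concl.ctx)

theorem traceMap_mem (R : Rule) (i : ℕ) (hi : i < R.prems.length) (x : ℕ) (a : Bool) (y : ℕ)
    (h : (x, a, y) ∈ traceMap R i) :
    x ∈ Finset.Icc 1 (numN R.concl.ctx) ∧ y ∈ Finset.Icc 1 (numN R.prems[i].ctx) := by
  cases R with
  | id => simp [Rule.prems] at hi
  | zero => simp [Rule.prems] at hi
  | succ => simp [Rule.prems] at hi
  | left Γ A B C =>
    obtain rfl | rfl : i = 0 ∨ i = 1 := by simp [Rule.prems] at hi; omega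
    all_goals
      simp_all [traceMap, idUpTo, Rule.concl, Rule.prems, numN, List.count_cons] <;> omega
  | cond Γ A =>
    obtain rfl | rfl : i = 0 ∨ i = 1 := by simp [Rule.prems] at hi; omega
    all_goals
      simp_all [traceMap, idUpTo, Rule.concl, Rule.prems, numN]
    all_goals omega
  | cut Γ B A =>
    obtain rfl | rfl : i = 0 ∨ i = 1 := by simp [Rule.prems] at hi; omega
    all_goals
      simp_all [traceMap, idUpTo, Rule.concl, Rule.prems, numN, List.count_cons] <;> omega
  | right Γ A B =>
    obtain rfl : i = 0 := by simp [Rule.prems] at hi; omega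
    simp_all [traceMap, idUpTo, Rule.concl, Rule.prems, numN, List.count_cons]
    omega
  | ex Γ A B Γ' C =>
    obtain rfl : i = 0 := by simp [Rule.prems] at hi; omega
    simp only [traceMap] at h
    split_ifs at h with hAB <;>
      simp_all [idUpTo, Rule.concl, Rule.prems, numN, List.count_cons] <;> omega
  | wk Γ A B =>
    obtain rfl : i = 0 := by simp [Rule.prems] at hi; omega
    simp only [traceMap] at h
    split_ifs at h with hA <;>
      simp_all [idUpTo, Rule.concl, Rule.prems, numN] <;> omega
  | ctr Γ A B =>
    obtain rfl : i = 0 := by simp [Rule.prems] at hi; omega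
    simp only [traceMap] at h
    split_ifs at h with hA <;>
      simp_all [idUpTo, Rule.concl, Rule.prems, numN] <;> omega

noncomputable def interp : TraceInterp deriv Bool where
  obj s := Finset.Icc 1 (numN s.ctx)
  mor := traceMap
  mor_mem := traceMap_mem

/-- Cyclic Gödel's T. -/
noncomputable def sys : CyclicSys := interp.cyclicSys

/-- `P` is a proof of `Γ ⇒ A` in cyclic Gödel's T. -/
def IsProofOf (P : Preproof deriv) (Γ : List Ty) (A : Ty) : Prop :=
  P ∈ sys.pfs ∧ P.endseq = (⟨Γ, A⟩ : Seq)

/-- The coterm denoted by a preproof of cyclic Gödel's T. -/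
def coterm (P : Preproof deriv) : Set (List ℕ × Rule) := P.content (fun R : Rule => some R)

end CGT

/-! ### Reset Gödel's T -/

namespace RGT

/-- A context: a list of types annotated with words. Letters are natural numbers. -/
abbrev Ctx := List (Ty × List ℕ)

structure RawSeq where
  ctrl : List ℕ
  ctx : Ctx
  ty : Ty

structure RawSeq.WF (s : RawSeq) : Prop where
  nodup : s.ctrl.Nodup
  sublist : ∀ p ∈ s.ctx, p.2.Sublist s.ctrl
  only_N : ∀ p ∈ s.ctx, p.1 ≠ .N → p.2 = []

/-- Sequents `ctrl | ctx ⇒ ty`. -/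
abbrev Seq := {s : RawSeq // s.WF}

/-- The control without the letters which do not occur in the context. -/
def clean (Θ : List ℕ) (Γ : Ctx) : List ℕ := Θ.filter fun γ => ∃ p ∈ Γ, γ ∈ p.2

inductive RawRule : Type
  | id (Θ : List ℕ) (A : Ty) (u : List ℕ) : RawRule
  | zero (Θ : List ℕ) : RawRule
  | succ (Θ u : List ℕ) : RawRule
  | left (Θ : List ℕ) (Γ : Ctx) (A B : Ty) (u : List ℕ) (C : Ty) : RawRule
  | right (Θ : List ℕ) (Γ : Ctx) (A B : Ty) : RawRule
  | cond (Θ : List ℕ) (Γ : Ctx) (u : List ℕ) (a : ℕ) (A : Ty) : RawRule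
  | ex (Θ : List ℕ) (Γ : Ctx) (A : Ty) (v : List ℕ) (B : Ty) (u : List ℕ) (Γ' : Ctx) (C : Ty) :
      RawRule
  | wk (Θ : List ℕ) (Γ : Ctx) (A : Ty) (u : List ℕ) (B : Ty) : RawRule
  | ctr (Θ : List ℕ) (Γ : Ctx) (A : Ty) (u : List ℕ) (B : Ty) : RawRule
  | cut (Θ : List ℕ) (Γ : Ctx) (B A : Ty) : RawRule
  | reset (Θ : List ℕ) (Γ : Ctx) (u : List ℕ) (a : ℕ) (us : List (List ℕ)) (B : Ty) : RawRule

namespace RawRule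

def concl : RawRule → RawSeq
  | id Θ A u => ⟨Θ, [(A, u)], A⟩
  | zero Θ => ⟨Θ, [], .N⟩
  | succ Θ u => ⟨Θ, [(.N, u)], .N⟩
  | left Θ Γ A B u C => ⟨Θ, Γ ++ [(.arr A B, u)], C⟩
  | right Θ Γ A B => ⟨Θ, Γ, .arr A B⟩
  | cond Θ Γ u _ A => ⟨Θ, Γ ++ [(.N, u)], A⟩
  | ex Θ Γ A v B u Γ' C => ⟨Θ, Γ ++ [(B, u), (A, v)] ++ Γ', C⟩
  | wk Θ Γ A u B => ⟨Θ, Γ ++ [(A, u)], B⟩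
  | ctr Θ Γ A u B => ⟨Θ, Γ ++ [(A, u)], B⟩
  | cut Θ Γ _ A => ⟨Θ, Γ, A⟩
  | reset Θ Γ u a us B => ⟨Θ, Γ ++ us.map (fun w => (.N, u ++ a :: w)), B⟩

def prems : RawRule → List RawSeq
  | id _ _ _ => []
  | zero _ => []
  | succ _ _ => []
  | left Θ Γ A B u C => [⟨clean Θ Γ, Γ, A⟩, ⟨Θ, Γ ++ [(B, u)], C⟩]
  | right Θ Γ A B => [⟨Θ, Γ ++ [(A, [])], B⟩]
  | cond Θ Γ u a A => [⟨clean Θ Γ, Γ, A⟩, ⟨Θ ++ [a], Γ ++ [(.N, u ++ [a])], A⟩]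
  | ex Θ Γ A v B u Γ' C => [⟨Θ, Γ ++ [(A, v), (B, u)] ++ Γ', C⟩]
  | wk Θ Γ _ _ B => [⟨clean Θ Γ, Γ, B⟩]
  | ctr Θ Γ A u B => [⟨Θ, Γ ++ [(A, u), (A, u)], B⟩]
  | cut Θ Γ B A => [⟨Θ, Γ, B⟩, ⟨Θ, Γ ++ [(B, [])], A⟩]
  | reset Θ Γ u a us B =>
      let Γ' := Γ ++ us.map (fun _ => (.N, u ++ [a]))
      [⟨clean Θ Γ', Γ', B⟩]

/-- The side conditions of the rules. In `reset`, `us` is the list `u₁, …, uₙ`; the letter `a` has to be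
covered, so it occurs, and is never the last letter of an annotation. -/
def Side : RawRule → Prop
  | cond Θ _ _ a _ => a ∉ Θ
  | reset _ Γ _ a us _ => us ≠ [] ∧ (∀ w ∈ us, w ≠ []) ∧ ∀ p ∈ Γ, a ∉ p.2
  | _ => True

/-- The corresponding rule of cyclic Gödel's T; `reset` has none. -/
def erase : RawRule → Option CGT.Rule
  | id _ A _ => some (.id A)
  | zero _ => some .zero
  | succ _ _ => some .succ
  | left _ Γ A B _ C => some (.left (Γ.map Prod.fst) A B C)
  | right _ Γ A B => some (.right (Γ.map Prod.fst) A B)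
  | cond _ Γ _ _ A => some (.cond (Γ.map Prod.fst) A)
  | ex _ Γ A _ B _ Γ' C => some (.ex (Γ.map Prod.fst) A B (Γ'.map Prod.fst) C)
  | wk _ Γ A _ B => some (.wk (Γ.map Prod.fst) A B)
  | ctr _ Γ A _ B => some (.ctr (Γ.map Prod.fst) A B)
  | cut _ Γ B A => some (.cut (Γ.map Prod.fst) B A)
  | reset _ _ _ _ _ _ => none

/-- The letter which is reset, if the rule is `reset`. -/
def letter : RawRule → Option ℕ
  | reset _ _ _ a _ _ => some a
  | _ => none

/-- Instances of the rules: conclusion and premises are sequents and the side condition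
holds. -/
structure Legal (R : RawRule) : Prop where
  concl_wf : R.concl.WF
  prems_wf : ∀ s ∈ R.prems, s.WF
  side : R.Side

end RawRule

abbrev Rule := {R : RawRule // R.Legal}

def deriv : DerivSys where
  Seq := Seq
  Rule := Rule
  concl R := ⟨R.1.concl, R.2.concl_wf⟩
  prems R := R.1.prems.pmap (fun s h => ⟨s, h⟩) R.2.prems_wf

/-- Reset Gödel's T. -/
def sys : CyclicSys where
  toDerivSys := deriv
  pfs := {P | P.IsPreproof ∧ P.assumptions = [] ∧
    P.HasInvariants (D := deriv) (fun s => s.1.ctrl) (fun R => R.1.letter)}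
  isPreproof_of_mem _ h := h.1
  closed_of_mem _ h := h.2.1

/-- The sequent `ε | Γ^ε ⇒ A`. -/
def plain (Γ : List Ty) (A : Ty) : Seq :=
  ⟨⟨[], Γ.map (fun B => (B, [])), A⟩, by constructor <;> simp⟩

/-- `P` is a proof of `Γ ⇒ A` in reset Gödel's T. -/
def IsProofOf (P : Preproof deriv) (Γ : List Ty) (A : Ty) : Prop :=
  P ∈ sys.pfs ∧ P.endseq = plain Γ A

/-- The coterm denoted by a preproof of reset Gödel's T: annotations are erased and resets are
skipped. -/
def coterm (P : Preproof deriv) : Set (List ℕ × CGT.Rule) :=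
  P.content (fun R : Rule => R.1.erase)

/-- The annotations of the occurrences of `N`, from left to right. -/
def annotations (Γ : Ctx) : List (List ℕ) := (Γ.filter fun p => p.1 = .N).map Prod.snd

/-- The board of a sequent: its control consists of the letters of the control which occur in the context
(a Safra board only has such chips), and on the square `(i, 0)` there is exactly one stack, the
set of letters of the annotation of the `i`-th occurrence of `N`. -/
def embedBoard (s : RawSeq) : Board Bool where
  ctrl := clean s.ctrl s.ctx
  stk i a := {S | a = false ∧ ∃ u, 1 ≤ i ∧ (annotations s.ctx)[i - 1]? = some u ∧
    S = u.toFinset}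

theorem embedBoard_isOn (s : RawSeq) (h : s.WF) :
    (embedBoard s).IsOn (Finset.Icc 1 (CGT.numN (s.ctx.map Prod.fst))) := by
  have hlen : (annotations s.ctx).length = CGT.numN (s.ctx.map Prod.fst) := by
    simp only [annotations, CGT.numN, List.length_map, List.count_eq_countP, List.countP_map]
    rw [← List.countP_eq_length_filter]
    congr 1
  refine ⟨h.nodup.filter _, ?_, ?_, ?_⟩
  · intro x hx a
    ext S
    simp only [embedBoard, Set.mem_ofPred_eq, Set.mem_empty_iff_false, iff_false]
    rintro ⟨-, u, h1, h2, -⟩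
    have := (List.getElem?_eq_some_iff.1 h2).1
    exact hx (Finset.mem_Icc.2 ⟨h1, by omega⟩)
  · rintro x a S ⟨-, u, -, h2, rfl⟩ γ hγ
    have hu := List.mem_of_getElem? h2
    simp only [annotations, List.mem_map, List.mem_filter] at hu
    obtain ⟨p, ⟨hp, -⟩, rfl⟩ := hu
    have hγ' := List.mem_toFinset.1 hγ
    simp only [embedBoard, clean, List.mem_filter, decide_eq_true_eq]
    exact ⟨(h.sublist p hp).subset hγ', p, hp, hγ'⟩
  · intro γ hγ
    simp only [embedBoard, clean, List.mem_filter, decide_eq_true_eq] at hγ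
    obtain ⟨-, p, hp, hγp⟩ := hγ
    have hN : p.1 = .N := by
      by_contra hN
      simp [h.only_N p hp hN] at hγp
    have hu : p.2 ∈ annotations s.ctx := by
      simp only [annotations, List.mem_map, List.mem_filter]
      exact ⟨p, ⟨hp, by simpa using hN⟩, rfl⟩
    obtain ⟨i, hi⟩ := List.mem_iff_getElem?.1 hu
    exact ⟨i + 1, false, p.2.toFinset, ⟨rfl, p.2, by omega, by simpa using hi, rfl⟩,
      List.mem_toFinset.2 hγp⟩

/-- The function from sequents of reset Gödel's T to sequents of the reset system of cyclic
Gödel's T. -/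
noncomputable def embedSeq (s : Seq) : CGT.interp.RSeq where
  seq := ⟨s.1.ctx.map Prod.fst, s.1.ty⟩
  board := embedBoard s.1
  isOn := embedBoard_isOn s.1 s.2

/-- The preproof `T` consists of one application of the rule of the reset system of cyclic
Gödel's T corresponding to `R`, with at most one application of `Pop` above each premise. -/
def Corresponds (R : Rule) (T : Preproof CGT.interp.resetDeriv) : Prop :=
  ∃ (Q : CGT.interp.RRule) (cs : Fin Q.prems.length → Preproof CGT.interp.resetDeriv),
    T = .infer (D := CGT.interp.resetDeriv) Q cs ∧ Q.base = R.1.erase ∧ Q.chip = R.1.letter ∧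
    ∀ i, (cs i).IsHyp ∨
      ∃ (Q' : CGT.interp.RRule) (cs' : Fin Q'.prems.length → Preproof CGT.interp.resetDeriv),
        cs i = .infer (D := CGT.interp.resetDeriv) Q' cs' ∧ Q'.IsPop ∧ ∀ j, (cs' j).IsHyp

end RGT

end CyclicGT

namespace CyclicGT

/-! ### Positions of preproofs -/

namespace Preproof

variable {D : DerivSys}

/-! An annotated sequent is a Safra board in disguise: the annotation of an occurrence of `N` is the
only stack on its square. Under every rule other than Reset, annotations move along the trace
relation of the underlying rule, as recorded by `Transfer`: a nonempty annotation in a premise is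
inherited unchanged, or with one fresh letter appended on the last occurrence. So the successor
board can differ from the image of the premise only by lacking empty stacks at occurrences without
predecessor, and Pop supplies these (`Transfer.isSuccessor`, `Transfer.isPopulation`). Reset matches
the reset of boards because annotations are subsequences of a control without repetitions: the
letters after `a` are exactly the chips above `a` (`isReset_embedBoard`).

Invariants need care, since the control of the image keeps only letters occurring in the context. A
letter that stays in the control and occurs in a premise occurs in the conclusion; bud and companion
carry the same sequent. Hence each letter of an invariant occurs at all nodes between companion and
bud or at none of them, and deleting the absent ones leaves an invariant
(`hasInvariants_embedProof`).

Stripping removes Pop and Reset nodes, and no cycle may vanish. Reset strictly decreases the total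
length of the annotations, so no cycle consists of resets alone (`weight_lt_of_pos_eq`,
`sub_stripped_bud`). The remaining nodes then correspond, which gives correctness of the labelling
and equality of the coterms.

The global trace condition is checked on the annotations of the original proof. A branch of the
stripped tree lifts to a branch of the proof (`exists_branch`). On it some letter `a` eventually
stays in the control and is reset infinitely often (`Preproof.HasInvariants.exists_letter`).
Occurrences carrying `a` have predecessors carrying `a`, so König's lemma yields a trace through
such occurrences. Right after a reset the annotation on it ends in `a`; at the next reset of `a` it
continues beyond `a`. Without progress annotations only pass to prefixes, so there is progress
between consecutive resets (`traceCondition_of_branch`). -/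

@[simp] theorem sub_nil (P : Preproof D) : P.sub [] = some P := by
  cases P <;> rfl

theorem sub_infer_cons {R : D.Rule} {cs : Fin (D.prems R).length → Preproof D} {i : ℕ} {t : List ℕ}
    (h : i < (D.prems R).length) : (infer R cs).sub (i :: t) = (cs ⟨i, h⟩).sub t := by
  simp [sub, h]

theorem sub_cons_eq_some {P Q : Preproof D} {i : ℕ} {t : List ℕ} :
    P.sub (i :: t) = some Q ↔
      ∃ R cs, ∃ h : i < (D.prems R).length, P = infer R cs ∧ (cs ⟨i, h⟩).sub t = some Q := by
  cases P with
  | hyp Γ => simp [sub]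
  | bud Γ k => simp [sub]
  | infer R cs =>
    constructor
    · intro h
      by_cases hi : i < (D.prems R).length
      · exact ⟨R, cs, hi, rfl, by rwa [sub_infer_cons hi] at h⟩
      · simp [sub, hi] at h
    · rintro ⟨R', cs', hi, h, h'⟩
      cases h
      rwa [sub_infer_cons hi]

theorem sub_append {P Q : Preproof D} {s : List ℕ} (w : List ℕ) (h : P.sub s = some Q) :
    P.sub (s ++ w) = Q.sub w := by
  induction s generalizing P with
  | nil => simp at h; simp [h]
  | cons i s ih =>
    obtain ⟨R, cs, hi, rfl, h'⟩ := sub_cons_eq_some.1 h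
    rw [List.cons_append, sub_infer_cons hi, ih h']

theorem exists_sub_of_prefix {P Q : Preproof D} {s t : List ℕ} (hs : s <+: t)
    (h : P.sub t = some Q) : ∃ Q', P.sub s = some Q' := by
  induction s generalizing P t with
  | nil => exact ⟨P, sub_nil P⟩
  | cons i s ih =>
    obtain ⟨w, rfl⟩ := hs
    rw [List.cons_append] at h
    obtain ⟨R, cs, hi, rfl, h'⟩ := sub_cons_eq_some.1 h
    rw [sub_infer_cons hi]
    exact ih (List.prefix_append s w) h'

theorem sub_snoc {P Q : Preproof D} {s : List ℕ} {i : ℕ} :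
    P.sub (s ++ [i]) = some Q ↔
      ∃ R cs, ∃ h : i < (D.prems R).length, P.sub s = some (infer R cs) ∧ Q = cs ⟨i, h⟩ := by
  constructor
  · intro h
    obtain ⟨Q', hQ'⟩ := exists_sub_of_prefix (List.prefix_append s [i]) h
    rw [sub_append _ hQ'] at h
    obtain ⟨R, cs, hi, rfl, h'⟩ := sub_cons_eq_some.1 h
    exact ⟨R, cs, hi, hQ', by simpa using h'.symm⟩
  · rintro ⟨R, cs, hi, h, rfl⟩
    rw [sub_append _ h, sub_infer_cons hi, sub_nil]

theorem companion_prefix (t : List ℕ) (k : ℕ) : companion t k <+: t := List.take_prefix _ _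

theorem companion_cons {i : ℕ} {t : List ℕ} {k : ℕ} (h : k < t.length) :
    companion (i :: t) k = i :: companion t k := by
  obtain ⟨m, hm⟩ : ∃ m, t.length = k + 1 + m := ⟨t.length - (k + 1), by omega⟩
  simp only [companion, List.length_cons]
  rw [show t.length + 1 - (k + 1) = (t.length - (k + 1)) + 1 by omega, List.take_succ_cons]

theorem length_companion {t : List ℕ} {k : ℕ} : (companion t k).length = t.length - (k + 1) := by
  simp [companion]

/-- Correctness of the labelling, expressed by positions. -/
structure WellLabelled (P : Preproof D) : Prop where
  child : ∀ t R cs, P.sub t = some (infer R cs) → ∀ i, (cs i).endseq = (D.prems R).get i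
  bud : ∀ t Γ k, P.sub t = some (bud Γ k) →
    k < t.length ∧ ∃ Q, P.sub (companion t k) = some Q ∧ Q.endseq = Γ

/-- In a subtree, a bud may point below the root. Its companion is then looked up in `below`, after
subtracting the height of the bud; this second alternative is what makes the induction go through.
-/
theorem correct_iff (P : Preproof D) (below : List D.Seq) : P.Correct below ↔
    (∀ t R cs, P.sub t = some (infer R cs) → ∀ i, (cs i).endseq = (D.prems R).get i) ∧
    ∀ t Γ k, P.sub t = some (.bud Γ k) →
      (k < t.length ∧ ∃ Q, P.sub (companion t k) = some Q ∧ Q.endseq = Γ) ∨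
      (t.length ≤ k ∧ below[k - t.length]? = some Γ) := by
  induction P generalizing below with
  | hyp Γ =>
    simp only [Correct, true_iff]
    constructor <;> intro t <;> cases t <;> simp [sub]
  | bud Γ k =>
    simp only [Correct]
    constructor
    · intro h
      constructor
      · intro t; cases t <;> simp [sub]
      · intro t Δ l
        cases t
        · simp only [sub_nil, Option.some.injEq, bud.injEq]
          rintro ⟨rfl, rfl⟩
          simpa using h
        · simp [sub]
    · intro h
      simpa using h.2 [] Γ k (sub_nil _)
  | infer R cs ih =>
    simp only [Correct, ih]
    constructor
    · intro h
      constructor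
      · intro t R' cs' ht
        cases t with
        | nil =>
          simp only [sub_nil, Option.some.injEq, infer.injEq] at ht
          obtain ⟨rfl, ht⟩ := ht
          cases ht
          exact fun i => (h i).1
        | cons i t =>
          obtain ⟨R₁, cs₁, hi, he, ht⟩ := sub_cons_eq_some.1 ht
          cases he
          exact (h ⟨i, hi⟩).2.1 t R' cs' ht
      · intro t Γ k ht
        cases t with
        | nil => simp at ht
        | cons i t =>
          obtain ⟨R₁, cs₁, hi, he, ht⟩ := sub_cons_eq_some.1 ht
          cases he
          rcases (h ⟨i, hi⟩).2.2 t Γ k ht with ⟨hk, Q, hQ, hΓ⟩ | ⟨hk, hb⟩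
          · refine .inl ⟨by simp; omega, Q, ?_, hΓ⟩
            rw [companion_cons hk, sub_infer_cons hi, hQ]
          · rcases hk.eq_or_lt with rfl | hk
            · refine .inl ⟨by simp, infer R cs, ?_, ?_⟩
              · simp [companion]
              · simpa [endseq] using hb
            · refine .inr ⟨by simp; omega, ?_⟩
              obtain ⟨m, rfl⟩ : ∃ m, k = t.length + 1 + m := ⟨k - (t.length + 1), by omega⟩
              rw [show t.length + 1 + m - t.length = m + 1 by omega] at hb
              simpa using hb
    · rintro ⟨h1, h2⟩ i
      refine ⟨h1 [] R cs (sub_nil _) i, fun t R' cs' ht => h1 (i :: t) R' cs' ?_, fun t Γ k ht => ?_⟩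
      · rw [sub_infer_cons i.2, ht]
      · rcases h2 (i :: t) Γ k (by rw [sub_infer_cons i.2, ht]) with ⟨hk, Q, hQ, hΓ⟩ | ⟨hk, hb⟩
        · rcases (Nat.lt_succ_iff.1 hk).eq_or_lt with rfl | hk
          · right
            simp [companion] at hQ
            subst hQ
            simpa [endseq] using hΓ
          · left
            rw [companion_cons hk, sub_infer_cons i.2] at hQ
            exact ⟨hk, Q, hQ, hΓ⟩
        · simp only [List.length_cons] at hk
          obtain ⟨m, rfl⟩ : ∃ m, k = t.length + 1 + m := ⟨k - (t.length + 1), by omega⟩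
          refine .inr ⟨by omega, ?_⟩
          rw [show t.length + 1 + m - t.length = m + 1 by omega]
          simpa using hb

theorem isPreproof_iff (P : Preproof D) : P.IsPreproof ↔ P.WellLabelled := by
  rw [IsPreproof, correct_iff]
  constructor
  · rintro ⟨h1, h2⟩
    exact ⟨h1, fun t Γ k ht => by simpa using h2 t Γ k ht⟩
  · rintro ⟨h1, h2⟩
    exact ⟨h1, fun t Γ k ht => .inl (h2 t Γ k ht)⟩

theorem assumptions_eq_nil_iff (P : Preproof D) :
    P.assumptions = [] ↔ ∀ t Γ, P.sub t ≠ some (hyp Γ) := by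
  induction P with
  | hyp Γ =>
    simp only [assumptions, List.cons_ne_self, false_iff]
    exact fun h => h [] Γ (sub_nil _)
  | bud Γ k =>
    simp only [assumptions, true_iff]
    intro t Γ
    cases t <;> simp [sub]
  | infer R cs ih =>
    simp only [assumptions, List.flatten_eq_nil_iff, List.mem_ofFn, forall_exists_index,
      forall_apply_eq_imp_iff, ih]
    constructor
    · intro h t Γ ht
      cases t with
      | nil => simp at ht
      | cons i t =>
        obtain ⟨R₁, cs₁, hi, he, ht⟩ := sub_cons_eq_some.1 ht
        cases he
        exact h ⟨i, hi⟩ t Γ ht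
    · intro h i t Γ ht
      exact h (i :: t) Γ (by rw [sub_infer_cons i.2, ht])

theorem finite_nodes (P : Preproof D) : {t | ∃ Q, P.sub t = some Q}.Finite := by
  induction P with
  | hyp Γ =>
    refine (Set.finite_singleton []).subset ?_
    rintro t ⟨Q, h⟩
    cases t <;> simp_all [sub]
  | bud Γ k =>
    refine (Set.finite_singleton []).subset ?_
    rintro t ⟨Q, h⟩
    cases t <;> simp_all [sub]
  | infer R cs ih =>
    refine ((Set.finite_singleton []).union
      (Set.finite_iUnion fun i => (ih i).image (List.cons i.1))).subset ?_
    rintro t ⟨Q, h⟩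
    cases t with
    | nil => simp
    | cons i t =>
      obtain ⟨R₁, cs₁, hi, he, ht⟩ := sub_cons_eq_some.1 h
      cases he
      exact .inr (Set.mem_iUnion.2 ⟨⟨i, hi⟩, t, ⟨Q, ht⟩, rfl⟩)

/-! ### Infinite branches -/

theorem Step.exists_sub {P : Preproof D} {s t : List ℕ} (h : P.Step s t) :
    ∃ Q, P.sub t = some Q := by
  rcases h with ⟨R, cs, i, hs, hi, rfl⟩ | ⟨Γ, k, hs, rfl⟩
  · exact ⟨_, sub_snoc.2 ⟨R, cs, hi, hs, rfl⟩⟩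
  · exact exists_sub_of_prefix (companion_prefix _ _) hs

theorem IsBranch.exists_sub {P : Preproof D} {π : ℕ → List ℕ} (h : P.IsBranch π) (n : ℕ) :
    ∃ Q, P.sub (π n) = some Q := by
  cases n with
  | zero => exact ⟨P, by rw [h.1, sub_nil]⟩
  | succ n => exact (h.2 n).exists_sub

/-- A branch enters the part of the tree above `s` only through `s`. -/
theorem Step.eq_of_prefix {P : Preproof D} {r s t : List ℕ} (h : P.Step r t) (hr : ¬ s <+: r)
    (ht : s <+: t) : t = s := by
  rcases h with ⟨R, cs, i, -, -, rfl⟩ | ⟨Γ, k, -, rfl⟩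
  · rcases List.prefix_concat_iff.1 ht with h | h
    · exact h.symm
    · exact absurd h hr
  · exact absurd (ht.trans (companion_prefix _ _)) hr

/-- A branch leaves the part of the tree above `s` only through buds with companions below `s`. -/
theorem Step.exists_bud {P : Preproof D} {r s t : List ℕ} (h : P.Step r t) (hr : s <+: r)
    (ht : ¬ s <+: t) : ∃ Γ k, P.sub r = some (bud Γ k) ∧ t = companion r k := by
  rcases h with ⟨R, cs, i, -, -, rfl⟩ | h
  · exact absurd (hr.trans (List.prefix_append _ _)) ht
  · exact h

/-- There are only finitely many nodes, so one can wait until all nodes with finitely many visits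
have been visited for the last time. -/
theorem IsBranch.eventually_frequently {P : Preproof D} {π : ℕ → List ℕ} (h : P.IsBranch π) :
    ∃ N, ∀ n, N ≤ n → ∀ M, ∃ m, M ≤ m ∧ π m = π n := by
  have hF := P.finite_nodes
  have key : ∀ t ∈ {t | ∃ Q, P.sub t = some Q},
      ∀ᶠ n in Filter.atTop, π n = t → ∀ M, ∃ m, M ≤ m ∧ π m = t := by
    intro t _
    by_cases ht : ∀ M, ∃ m, M ≤ m ∧ π m = t
    · exact .of_forall fun _ _ => ht
    · push Not at ht
      obtain ⟨M, hM⟩ := ht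
      filter_upwards [Filter.eventually_ge_atTop M] with n hn hnt
      exact absurd hnt (hM n hn)
  obtain ⟨N, hN⟩ := Filter.eventually_atTop.1 ((Filter.eventually_all_finite hF).2 key)
  exact ⟨N, fun n hn => hN n hn (π n) (h.exists_sub n) rfl⟩

/-- From some point on, consecutive nodes of a branch lie between a bud which is visited later and its
companion. -/
theorem IsBranch.exists_interval {P : Preproof D} {π : ℕ → List ℕ} (h : P.IsBranch π) {n : ℕ}
    (hn : ∃ m, n < m ∧ π m = π n) :
    ∃ m Γ k, n ≤ m ∧ P.sub (π m) = some (bud Γ k) ∧ companion (π m) k <+: π n ∧ π n <+: π m ∧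
      companion (π m) k <+: π (n + 1) ∧ π (n + 1) <+: π m := by
  classical
  rcases h.2 n with ⟨R, cs, i, hs, hi, hi'⟩ | ⟨Γ, k, hs, hk⟩
  · obtain ⟨m₀, hm₀, hm₀'⟩ := hn
    -- The branch returns to `π n`, which is shorter than its child `π (n + 1)`, so it has to leave
    -- the part above that child. The node just before the first exit is the required bud.
    have hex : ∃ m, n < m ∧ ¬ π (n + 1) <+: π m := by
      refine ⟨m₀, hm₀, fun hp => ?_⟩
      have := hp.length_le
      rw [hm₀', hi'] at this
      simp at this
    obtain ⟨h1, h2⟩ := Nat.find_spec hex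
    obtain ⟨m, hm⟩ : ∃ m, Nat.find hex = m + 1 := ⟨Nat.find hex - 1, by omega⟩
    rw [hm] at h1 h2
    have hnm : n < m := by
      rcases Nat.lt_succ_iff_lt_or_eq.1 h1 with h | rfl
      · exact h
      · exact absurd List.prefix_rfl h2
    have h3 : π (n + 1) <+: π m := by
      by_contra h3
      exact Nat.find_min hex (m := m) (by omega) ⟨hnm, h3⟩
    obtain ⟨Γ, k, hb, hc⟩ := (h.2 m).exists_bud h3 h2
    -- The companion is on the path to `π m` but outside the part above `π (n + 1)`, hence at most
    -- as high as `π n`.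
    have h4 : companion (π m) k <+: π n := by
      rcases List.prefix_or_prefix_of_prefix (companion_prefix (π m) k) h3 with h | h
      · rw [hi'] at h
        rcases List.prefix_concat_iff.1 h with h | h
        · rw [← hi', ← hc] at h
          exact absurd (h ▸ List.prefix_rfl) h2
        · exact h
      · exact absurd (hc ▸ h) h2
    have h5 : π n <+: π (n + 1) := hi' ▸ List.prefix_append _ _
    exact ⟨m, Γ, k, hnm.le, hb, h4, h5.trans h3, h4.trans h5, h3⟩
  · exact ⟨n, Γ, k, le_rfl, hs, companion_prefix _ _, List.prefix_rfl, hk ▸ List.prefix_rfl,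
      hk ▸ companion_prefix _ _⟩

/-- Every node between an infinitely often visited bud and its companion is visited infinitely often. -/
theorem IsBranch.frequently_of_between {P : Preproof D} {π : ℕ → List ℕ} (h : P.IsBranch π)
    {t s : List ℕ} {Γ : D.Seq} {k : ℕ} (ht : ∀ M, ∃ m, M ≤ m ∧ π m = t)
    (hb : P.sub t = some (bud Γ k)) (hs : companion t k <+: s) (hst : s <+: t) (M : ℕ) :
    ∃ m, M ≤ m ∧ π m = s := by
  classical
  -- After one visit of the bud the branch is at the companion, which is not above `s` unless equal
  -- to it; before the next visit it must enter the part above `s`, and it can do so only through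
  -- `s`.
  obtain ⟨m₁, h1, h1'⟩ := ht M
  obtain ⟨m₂, h2, h2'⟩ := ht (m₁ + 1)
  have hc : π (m₁ + 1) = companion t k := by
    rcases h.2 m₁ with ⟨R, cs, i, hs, hi, hi'⟩ | ⟨Γ', k', hs, hk⟩
    · rw [h1', hb] at hs
      cases hs
    · rw [h1', hb] at hs
      cases hs
      rw [hk, h1']
  have hex : ∃ m, m₁ + 1 ≤ m ∧ s <+: π m := ⟨m₂, h2, h2' ▸ hst⟩
  obtain ⟨h3, h4⟩ := Nat.find_spec hex
  rcases h3.eq_or_lt with h5 | h5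
  · rw [← h5, hc] at h4
    exact ⟨m₁ + 1, by omega, by rw [hc]; exact hs.eq_of_length_le h4.length_le⟩
  · obtain ⟨m, hm⟩ : ∃ m, Nat.find hex = m + 1 := ⟨Nat.find hex - 1, by omega⟩
    rw [hm] at h4 h5
    refine ⟨m + 1, by omega, (h.2 m).eq_of_prefix (fun h6 => ?_) h4⟩
    exact Nat.find_min hex (m := m) (by omega) ⟨by omega, h6⟩

/-- On every infinite branch of a preproof with invariants, some letter eventually stays in the control
and is reset infinitely often. -/
theorem HasInvariants.exists_letter {ctrl : D.Seq → List ℕ} {resets : D.Rule → Option ℕ}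
    {P : Preproof D} (hI : P.HasInvariants ctrl resets) {π : ℕ → List ℕ} (h : P.IsBranch π) :
    ∃ N a, (∀ n Q, N ≤ n → P.sub (π n) = some Q → a ∈ ctrl Q.endseq) ∧
      ∀ M, ∃ n R cs, M ≤ n ∧ P.sub (π n) = some (infer R cs) ∧ resets R = some a := by
  classical
  obtain ⟨N, hN⟩ := h.eventually_frequently
  have hint := fun n (hn : N ≤ n) => h.exists_interval (n := n)
    (by obtain ⟨m, h1, h2⟩ := hN n hn (n + 1); exact ⟨m, h1, h2⟩)
  choose! U A hUA hR using hI
  -- Among all buds visited from `N` on, take one with the shortest invariant word: its invariant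
  -- persists along the whole rest of the branch.
  let len : ℕ → Prop := fun l => ∃ m Γ k, N ≤ m ∧ P.sub (π m) = some (bud Γ k) ∧
    (U (π m) Γ k).length = l
  have hlen : ∃ l, len l := by
    obtain ⟨m, Γ, k, hm, hb, -⟩ := hint N le_rfl
    exact ⟨_, m, Γ, k, hm, hb, rfl⟩
  obtain ⟨m, Γ, k, hm, hb, hl⟩ := Nat.find_spec hlen
  have hpre : ∀ n Q, m ≤ n → P.sub (π n) = some Q →
      U (π m) Γ k ++ [A (π m) Γ k] <+: ctrl Q.endseq := by
    intro n Q hn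
    induction n, hn using Nat.le_induction generalizing Q with
    | base => exact hUA _ _ _ hb _ _ (companion_prefix _ _) List.prefix_rfl
    | succ n hn ih =>
      intro hQ
      obtain ⟨m', Γ', k', hm', hb', h1, h2, h3, h4⟩ := hint n (hm.trans hn)
      obtain ⟨Q₀, hQ₀⟩ := h.exists_sub n
      have h5 := hUA _ _ _ hb' _ _ h1 h2 hQ₀
      have h6 := hUA _ _ _ hb' _ _ h3 h4 hQ
      -- The chosen invariant and that of the interval around `n` and `n + 1` are both prefixes of
      -- the control at `n`. By minimality the chosen one is a prefix of the other, which is also a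
      -- prefix of the control at `n + 1`.
      refine (List.prefix_of_prefix_length_le (ih Q₀ hQ₀) h5 ?_).trans h6
      have : Nat.find hlen ≤ (U (π m') Γ' k').length :=
        Nat.find_min' hlen ⟨m', Γ', k', by omega, hb', rfl⟩
      simp
      omega
  refine ⟨m, A (π m) Γ k, fun n Q hn hQ => (hpre n Q hn hQ).subset (by simp), fun M => ?_⟩
  obtain ⟨s, R, cs, h1, h2, h3, h4⟩ := hR _ _ _ hb
  obtain ⟨n, hn, hns⟩ := h.frequently_of_between (hN m hm) hb h1 h2 M
  exact ⟨n, R, cs, hn, hns ▸ h3, h4⟩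

end Preproof

namespace RGT

/-! ### Annotations of occurrences -/

/-- The `i`-th occurrence of `N` in the context is `N^u`. -/
def Ann (Γ : Ctx) (i : ℕ) (u : List ℕ) : Prop := 1 ≤ i ∧ (annotations Γ)[i - 1]? = some u

theorem annotations_append (Γ Δ : Ctx) :
    annotations (Γ ++ Δ) = annotations Γ ++ annotations Δ := by
  simp [annotations]

theorem annotations_cons_N (u : List ℕ) (Γ : Ctx) :
    annotations ((.N, u) :: Γ) = u :: annotations Γ := by
  simp [annotations]

theorem annotations_cons_of_ne {A : Ty} (hA : A ≠ .N) (u : List ℕ) (Γ : Ctx) :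
    annotations ((A, u) :: Γ) = annotations Γ := by
  simp [annotations, hA]

theorem annotations_nil : annotations [] = [] := rfl

theorem numN_map_fst (Γ : Ctx) : CGT.numN (Γ.map Prod.fst) = (annotations Γ).length := by
  simp only [annotations, CGT.numN, List.length_map, List.count_eq_countP, List.countP_map]
  rw [← List.countP_eq_length_filter]
  congr 1

theorem Ann.mem_Icc {Γ : Ctx} {i : ℕ} {u : List ℕ} (h : Ann Γ i u) :
    i ∈ Finset.Icc 1 (CGT.numN (Γ.map Prod.fst)) := by
  have := (List.getElem?_eq_some_iff.1 h.2).1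
  rw [numN_map_fst, Finset.mem_Icc]
  have := h.1
  omega

theorem Ann.unique {Γ : Ctx} {i : ℕ} {u v : List ℕ} (hu : Ann Γ i u) (hv : Ann Γ i v) : u = v :=
  Option.some.inj (hu.2.symm.trans hv.2)

theorem Ann.exists_mem {Γ : Ctx} {i : ℕ} {u : List ℕ} (h : Ann Γ i u) : ∃ p ∈ Γ, p.2 = u := by
  have hu := List.mem_of_getElem? h.2
  simp only [annotations, List.mem_map, List.mem_filter] at hu
  obtain ⟨p, ⟨hp, -⟩, rfl⟩ := hu
  exact ⟨p, hp, rfl⟩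

/-- Types other than `N` have empty annotations, so a letter can only sit on an occurrence of `N`.
-/
theorem RawSeq.WF.exists_ann {s : RawSeq} (h : s.WF) {γ : ℕ} (hγ : ∃ p ∈ s.ctx, γ ∈ p.2) :
    ∃ i u, Ann s.ctx i u ∧ γ ∈ u := by
  obtain ⟨p, hp, hγp⟩ := hγ
  have hN : p.1 = .N := by
    by_contra hN
    simp [h.only_N p hp hN] at hγp
  have hu : p.2 ∈ annotations s.ctx := by
    simp only [annotations, List.mem_map, List.mem_filter]
    exact ⟨p, ⟨hp, by simpa using hN⟩, rfl⟩
  obtain ⟨i, hi⟩ := List.mem_iff_getElem?.1 hu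
  exact ⟨i + 1, p.2, ⟨by omega, by simpa using hi⟩, hγp⟩

theorem RawSeq.WF.exists_mem_iff {s : RawSeq} (h : s.WF) {γ : ℕ} :
    (∃ p ∈ s.ctx, γ ∈ p.2) ↔ ∃ i u, Ann s.ctx i u ∧ γ ∈ u := by
  refine ⟨h.exists_ann, ?_⟩
  rintro ⟨i, u, hu, hγ⟩
  obtain ⟨p, hp, rfl⟩ := hu.exists_mem
  exact ⟨p, hp, hγ⟩

theorem RawSeq.WF.ann_sublist {s : RawSeq} (h : s.WF) {i : ℕ} {u : List ℕ} (hu : Ann s.ctx i u) :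
    u.Sublist s.ctrl := by
  obtain ⟨p, hp, rfl⟩ := hu.exists_mem
  exact h.sublist p hp

theorem mem_clean {Θ : List ℕ} {Γ : Ctx} {γ : ℕ} :
    γ ∈ clean Θ Γ ↔ γ ∈ Θ ∧ ∃ p ∈ Γ, γ ∈ p.2 := by
  simp [clean]

theorem mem_embedBoard_stk {s : RawSeq} {i : ℕ} {a : Bool} {S : Finset ℕ} :
    S ∈ (embedBoard s).stk i a ↔ a = false ∧ ∃ u, Ann s.ctx i u ∧ S = u.toFinset := by
  simp [embedBoard, Ann, and_assoc]

theorem clean_eq_filter {Θ : List ℕ} {Γ Γ' : Ctx} {p : ℕ → Bool}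
    (h : ∀ γ ∈ Θ, (∃ q ∈ Γ', γ ∈ q.2) ↔ p γ = true ∧ ∃ q ∈ Γ, γ ∈ q.2) :
    clean Θ Γ' = (clean Θ Γ).filter p := by
  simp only [clean, List.filter_filter]
  refine List.filter_congr fun γ hγ => ?_
  rw [Bool.eq_iff_iff, Bool.and_eq_true, decide_eq_true_iff, decide_eq_true_iff]
  exact h γ hγ

theorem clean_clean (Θ : List ℕ) (Γ : Ctx) : clean (clean Θ Γ) Γ = clean Θ Γ := by
  simp [clean, List.filter_filter]

/-! ### Traces and annotations -/

/-- The relation `τ` describes how the annotations of the premise `s'` arise from the annotations of the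
conclusion `s`. -/
structure Transfer (s s' : RawSeq) (τ : TraceRel Bool) : Prop where
  same : ∀ x y, (x, false, y) ∈ τ → ∃ v, Ann s.ctx x v ∧ Ann s'.ctx y v
  progress : ∀ x y, (x, true, y) ∈ τ → ∃ u a, a ∉ s.ctrl ∧ s'.ctrl = s.ctrl ++ [a] ∧
    y = (annotations s'.ctx).length ∧ Ann s.ctx x u ∧ Ann s'.ctx y (u ++ [a])
  pred : ∀ y v, Ann s'.ctx y v → v ≠ [] → ∃ x c, (x, c, y) ∈ τ
  ctrl : (∀ x y, (x, true, y) ∉ τ) → s'.ctrl = s.ctrl ∨ s'.ctrl = clean s.ctrl s'.ctx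

/-- All stacks start in the column `false`, so the column in which they arrive is the progress value
of the trace itself. -/
theorem mem_moved_embedBoard {s : RawSeq} {τ : TraceRel Bool} {y : ℕ} {c : Bool} {S : Finset ℕ} :
    S ∈ (embedBoard s).moved τ y c ↔ ∃ x u, (x, c, y) ∈ τ ∧ Ann s.ctx x u ∧ S = u.toFinset := by
  simp only [Board.moved, Set.mem_ofPred_eq, mem_embedBoard_stk]
  constructor
  · rintro ⟨x, c', e, ⟨rfl, u, hu, rfl⟩, h, rfl⟩
    exact ⟨x, u, by simpa using h, hu, rfl⟩
  · rintro ⟨x, u, h, hu, rfl⟩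
    exact ⟨x, c, false, ⟨rfl, u, hu, rfl⟩, h, by simp⟩

/-- The successor board along `τ`: the board of `s'` without the stacks which do not come from the
conclusion. -/
def succBoard (s' : RawSeq) (τ : TraceRel Bool) : Board Bool where
  ctrl := clean s'.ctrl s'.ctx
  stk y c := {S | S ∈ (embedBoard s').stk y c ∧ ∃ x e, (x, e, y) ∈ τ}

namespace Transfer

variable {s s' : RawSeq} {τ : TraceRel Bool}

/-- Discarding the stacks without predecessor loses no chip: by `pred` they are empty. -/
theorem isOn (h : Transfer s s' τ) (hs' : s'.WF) :
    (succBoard s' τ).IsOn (Finset.Icc 1 (CGT.numN (s'.ctx.map Prod.fst))) := by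
  have hE := embedBoard_isOn s' hs'
  refine ⟨hE.nodup, ?_, ?_, ?_⟩
  · intro x hx a
    ext S
    simp [succBoard, hE.stk_empty x hx a]
  · exact fun x a S hS => hE.stack_sub x a S hS.1
  · intro γ hγ
    obtain ⟨i, u, hu, hγu⟩ := hs'.exists_ann (mem_clean.1 hγ).2
    refine ⟨i, false, u.toFinset, ⟨mem_embedBoard_stk.2 ⟨rfl, u, hu, rfl⟩, ?_⟩, by simpa⟩
    exact h.pred i u hu (List.ne_nil_of_mem hγu)

/-- The missing stacks belong to occurrences without predecessor. By `pred` these have annotation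
`[]`, and empty stacks are just what Pop may add. -/
theorem isPopulation (h : Transfer s s' τ) : (succBoard s' τ).IsPopulation (embedBoard s') := by
  refine ⟨rfl, fun x => ⟨fun S hS => hS.1, fun S hS => ?_⟩, fun x a ha => ?_⟩
  · obtain ⟨-, u, hu, rfl⟩ := mem_embedBoard_stk.1 hS
    by_cases hu0 : u = []
    · right
      simp [hu0]
    · exact .inl ⟨hS, h.pred x u hu hu0⟩
  · have ha' : a = true := by simpa using ha
    subst ha'
    ext S
    simp [succBoard, mem_embedBoard_stk]

/-- The letters of the old control which occur in the premise are those on the moved stacks. -/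
theorem exists_mem_iff (h : Transfer s s' τ) (hs : s.WF) (hs' : s'.WF) {γ : ℕ} (hγ : γ ∈ s.ctrl) :
    (∃ p ∈ s'.ctx, γ ∈ p.2) ↔
      (∃ y ∈ Finset.Icc 1 (CGT.numN (s'.ctx.map Prod.fst)), ∃ c,
        ∃ S ∈ (embedBoard s).moved τ y c, γ ∈ S) ∧ ∃ p ∈ s.ctx, γ ∈ p.2 := by
  rw [hs.exists_mem_iff, hs'.exists_mem_iff]
  constructor
  · rintro ⟨y, v, hv, hγv⟩
    obtain ⟨x, c, hxy⟩ := h.pred y v hv (List.ne_nil_of_mem hγv)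
    obtain ⟨u, hu, hγu⟩ : ∃ u, Ann s.ctx x u ∧ γ ∈ u := by
      cases c
      · obtain ⟨u, hu, hu'⟩ := h.same x y hxy
        exact ⟨u, hu, hu'.unique hv ▸ hγv⟩
      · obtain ⟨u, a, ha, -, -, hu, hu'⟩ := h.progress x y hxy
        rw [hv.unique hu'] at hγv
        rcases List.mem_append.1 hγv with h1 | h1
        · exact ⟨u, hu, h1⟩
        · rw [List.mem_singleton.1 h1] at hγ
          exact absurd hγ ha
    exact ⟨⟨y, hv.mem_Icc, c, u.toFinset, mem_moved_embedBoard.2 ⟨x, u, hxy, hu, rfl⟩, by simpa⟩,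
      x, u, hu, hγu⟩
  · rintro ⟨⟨y, -, c, S, hS, hγS⟩, -⟩
    obtain ⟨x, u, hxy, hu, rfl⟩ := mem_moved_embedBoard.1 hS
    have hγu : γ ∈ u := by simpa using hγS
    cases c
    · obtain ⟨v, hv, hv'⟩ := h.same x y hxy
      exact ⟨y, v, hv', hv.unique hu ▸ hγu⟩
    · obtain ⟨v, a, -, -, -, hv, hv'⟩ := h.progress x y hxy
      exact ⟨y, _, hv', List.mem_append_left _ (hv.unique hu ▸ hγu)⟩

theorem clean_eq (h : Transfer s s' τ) (hs : s.WF) (hs' : s'.WF) {p : ℕ → Bool}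
    (hp : ∀ γ, p γ = true ↔ ∃ y ∈ Finset.Icc 1 (CGT.numN (s'.ctx.map Prod.fst)), ∃ c,
        ∃ S ∈ (embedBoard s).moved τ y c, γ ∈ S) :
    clean s.ctrl s'.ctx = (embedBoard s).ctrl.filter p :=
  clean_eq_filter fun γ hγ => by rw [hp]; exact h.exists_mem_iff hs hs' hγ

/-- The two controls determine the progressing letter, and the target of progress is always the last
occurrence. So at most one new chip is needed, and that letter can serve as the chip. -/
theorem isSuccessor (h : Transfer s s' τ) (hs : s.WF) (hs' : s'.WF) :
    Board.IsSuccessor τ (Finset.Icc 1 (CGT.numN (s'.ctx.map Prod.fst))) (embedBoard s)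
      (succBoard s' τ) := by
  classical
  by_cases hp : ∃ x y, (x, true, y) ∈ τ
  · obtain ⟨x₀, y₀, h₀⟩ := hp
    obtain ⟨u₀, a, ha, hctrl, hy₀, hu₀, hu₀'⟩ := h.progress x₀ y₀ h₀
    have hprog : ∀ x y, (x, true, y) ∈ τ → y = y₀ ∧
        ∃ u, Ann s.ctx x u ∧ Ann s'.ctx y (u ++ [a]) := by
      intro x y hxy
      obtain ⟨u, b, -, hb, hy, hu, hu'⟩ := h.progress x y hxy
      have hab : b = a := by
        have := hb.symm.trans hctrl
        simpa using this
      subst hab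
      exact ⟨hy.trans hy₀.symm, u, hu, hu'⟩
    refine ⟨[a], fun _ => a, by simp, ?_, ?_, ?_, ?_⟩
    · simp only [List.mem_singleton, forall_eq]
      exact fun h => ha (mem_clean.1 h).1
    · have : {y | y ∈ Finset.Icc 1 (CGT.numN (s'.ctx.map Prod.fst)) ∧
          ((embedBoard s).moved τ y ActivationAlgebra.act).Nonempty} = {y₀} := by
        ext y
        simp only [Set.mem_ofPred_eq, Set.mem_singleton_iff]
        constructor
        · rintro ⟨-, S, hS⟩
          obtain ⟨x, u, hxy, -⟩ := mem_moved_embedBoard.1 hS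
          exact (hprog x y hxy).1
        · rintro rfl
          exact ⟨hu₀'.mem_Icc, _, mem_moved_embedBoard.2 ⟨x₀, u₀, h₀, hu₀, rfl⟩⟩
      rw [this]
      simp [Set.BijOn, Set.MapsTo, Set.InjOn, Set.SurjOn]
    · change clean s'.ctrl s'.ctx = _
      refine Eq.trans ?_ (congrArg (· ++ [a])
        (h.clean_eq hs hs' fun γ => by exact @decide_eq_true_iff _ (_)))
      rw [hctrl]
      -- The fresh letter occurs in the premise, so cleaning the control keeps it on top.
      obtain ⟨p, hp, hpa⟩ := hu₀'.exists_mem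
      have : ∃ p ∈ s'.ctx, a ∈ p.2 := ⟨p, hp, by simp [hpa]⟩
      simp only [clean, List.filter_append]
      congr 1
      simpa using this
    · intro y c
      split_ifs with h1 h2
      · have hc : c = true := h1
        subst hc
        ext S
        simp [succBoard, mem_embedBoard_stk]
      · have hc : c = false := h2
        subst hc
        ext S
        simp only [succBoard, Set.mem_ofPred_eq, Set.mem_union, mem_embedBoard_stk, true_and]
        constructor
        · rintro ⟨⟨v, hv, rfl⟩, x, c, hxy⟩
          cases c
          · obtain ⟨u, hu, hu'⟩ := h.same x y hxy
            exact .inl (mem_moved_embedBoard.2 ⟨x, v, hxy, hu'.unique hv ▸ hu, rfl⟩)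
          · obtain ⟨-, u, hu, hu'⟩ := hprog x y hxy
            refine .inr ⟨u.toFinset, mem_moved_embedBoard.2 ⟨x, u, hxy, hu, rfl⟩, ?_⟩
            rw [hv.unique hu']
            ext; simp
        · rintro (hS | ⟨S, hS, rfl⟩)
          · obtain ⟨x, u, hxy, hu, rfl⟩ := mem_moved_embedBoard.1 hS
            obtain ⟨v, hv, hv'⟩ := h.same x y hxy
            exact ⟨⟨u, hv.unique hu ▸ hv', rfl⟩, x, false, hxy⟩
          · obtain ⟨x, u, hxy, hu, rfl⟩ := mem_moved_embedBoard.1 hS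
            obtain ⟨-, v, hv, hv'⟩ := hprog x y hxy
            refine ⟨⟨v ++ [a], hv', ?_⟩, x, true, hxy⟩
            rw [hv.unique hu]
            ext; simp
      · cases c
        · exact absurd rfl h2
        · exact absurd rfl h1
  · push Not at hp
    have hmoved : ∀ y, (embedBoard s).moved τ y ActivationAlgebra.act = ∅ := by
      intro y
      ext S
      simp only [Set.mem_empty_iff_false, iff_false]
      intro hS
      obtain ⟨x, u, hxy, -⟩ := mem_moved_embedBoard.1 hS
      exact hp x y hxy
    refine ⟨[], fun _ => 0, by simp, by simp, ?_, ?_, ?_⟩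
    · simp [hmoved]
    · change clean s'.ctrl s'.ctx = _
      rw [List.append_nil]
      refine Eq.trans ?_ (h.clean_eq hs hs' fun γ => by exact @decide_eq_true_iff _ (_))
      -- Whether the rule itself cleans the control of its premise is irrelevant, because the image
      -- of a sequent always has a cleaned control.
      rcases h.ctrl hp with h | h
      · rw [h]
      · rw [h, clean_clean]
    · intro y c
      split_ifs with h1 h2
      · have hc : c = true := h1
        subst hc
        ext S
        simp [succBoard, mem_embedBoard_stk]
      · have hc : c = false := h2
        subst hc
        rw [hmoved]
        ext S
        simp only [succBoard, Set.mem_ofPred_eq, Set.mem_union, mem_embedBoard_stk, true_and,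
          Set.mem_empty_iff_false, false_and, exists_false, or_false]
        constructor
        · rintro ⟨⟨v, hv, rfl⟩, x, c, hxy⟩
          cases c
          · obtain ⟨u, hu, hu'⟩ := h.same x y hxy
            exact mem_moved_embedBoard.2 ⟨x, v, hxy, hu'.unique hv ▸ hu, rfl⟩
          · exact absurd hxy (hp x y)
        · intro hS
          obtain ⟨x, u, hxy, hu, rfl⟩ := mem_moved_embedBoard.1 (by simpa using hS)
          obtain ⟨v, hv, hv'⟩ := h.same x y hxy
          exact ⟨⟨u, hv.unique hu ▸ hv', rfl⟩, x, false, hxy⟩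
      · cases c
        · exact absurd rfl h2
        · exact absurd rfl h1

end Transfer

theorem mem_idUpTo {n x y : ℕ} {c : Bool} :
    (x, c, y) ∈ CGT.idUpTo n ↔ 1 ≤ x ∧ x ≤ n ∧ c = false ∧ x = y :=
  ⟨fun ⟨h1, h2, h3, h4⟩ => ⟨h1, h2, h3, h4.symm⟩, fun ⟨h1, h2, h3, h4⟩ => ⟨h1, h2, h3, h4.symm⟩⟩

/-- `L` lists the occurrences kept by the rule. Those in `L₁` disappear; those in `L₂` are new and
satisfy `pred` vacuously, having empty annotations. -/
theorem transfer_idUpTo {s s' : RawSeq} {L L₁ L₂ : List (List ℕ)}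
    (h : annotations s.ctx = L ++ L₁) (h' : annotations s'.ctx = L ++ L₂) (hL : ∀ v ∈ L₂, v = [])
    (hc : s'.ctrl = s.ctrl ∨ s'.ctrl = clean s.ctrl s'.ctx) :
    Transfer s s' (CGT.idUpTo L.length) := by
  refine ⟨?_, ?_, ?_, fun _ => hc⟩
  · rintro x y hxy
    obtain ⟨h1, h2, -, hyx⟩ := mem_idUpTo.1 hxy
    subst hyx
    obtain ⟨v, hv⟩ : ∃ v, L[x - 1]? = some v := ⟨_, List.getElem?_eq_getElem (by omega)⟩
    refine ⟨v, ⟨h1, ?_⟩, ⟨h1, ?_⟩⟩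
    · rw [h, List.getElem?_append_left (by omega), hv]
    · rw [h', List.getElem?_append_left (by omega), hv]
  · rintro x y ⟨-, -, h3, -⟩
    cases h3
  · rintro y v ⟨h1, h2⟩ hv
    refine ⟨y, false, h1, ?_, rfl, rfl⟩
    by_contra hy
    simp only [not_le] at hy
    rw [h', List.getElem?_append_right (by omega)] at h2
    exact hv (hL v (List.mem_of_getElem? h2))

theorem transfer_cond {s s' : RawSeq} {L : List (List ℕ)} {u : List ℕ} {a : ℕ}
    (h : annotations s.ctx = L ++ [u]) (h' : annotations s'.ctx = L ++ [u ++ [a]])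
    (ha : a ∉ s.ctrl) (hc : s'.ctrl = s.ctrl ++ [a]) :
    Transfer s s' (CGT.idUpTo L.length ∪ {(L.length + 1, true, L.length + 1)}) := by
  refine ⟨?_, ?_, ?_, fun hp => absurd (.inr rfl) (hp (L.length + 1) (L.length + 1))⟩
  · rintro x y (hxy | h)
    · obtain ⟨h1, h2, -, hyx⟩ := mem_idUpTo.1 hxy
      subst hyx
      obtain ⟨v, hv⟩ : ∃ v, L[x - 1]? = some v := ⟨_, List.getElem?_eq_getElem (by omega)⟩
      refine ⟨v, ⟨h1, ?_⟩, ⟨h1, ?_⟩⟩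
      · rw [h, List.getElem?_append_left (by omega), hv]
      · rw [h', List.getElem?_append_left (by omega), hv]
    · simp at h
  · rintro x y (⟨-, -, h3, -⟩ | hxy)
    · cases h3
    · simp only [Set.mem_singleton_iff, Prod.mk.injEq, true_and] at hxy
      obtain ⟨rfl, rfl⟩ := hxy
      exact ⟨u, a, ha, hc, by simp [h'], by simp [Ann, h], by simp [Ann, h']⟩
  · rintro y v ⟨h1, h2⟩ -
    have h3 := (List.getElem?_eq_some_iff.1 h2).1
    rw [h'] at h3
    simp only [List.length_append, List.length_singleton] at h3
    rcases lt_or_ge L.length y with h4 | h4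
    · obtain rfl : y = L.length + 1 := by omega
      exact ⟨_, _, .inr rfl⟩
    · exact ⟨y, false, .inl ⟨h1, h4, rfl, rfl⟩⟩

theorem transfer_ex {s s' : RawSeq} {L L' : List (List ℕ)} {u v : List ℕ} {n : ℕ}
    (h : annotations s.ctx = L ++ [u, v] ++ L') (h' : annotations s'.ctx = L ++ [v, u] ++ L')
    (hn : n = L.length + 2 + L'.length) (hc : s'.ctrl = s.ctrl) :
    Transfer s s' ({p | p ∈ CGT.idUpTo n ∧ (p.1 ≤ L.length ∨ L.length + 2 < p.1)} ∪
      {(L.length + 1, false, L.length + 2), (L.length + 2, false, L.length + 1)}) := by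
  subst hn
  refine ⟨?_, ?_, ?_, fun _ => .inl hc⟩
  · rintro x y (⟨hxy, h3⟩ | hxy)
    · obtain ⟨h1, h2, -, hyx⟩ := mem_idUpTo.1 hxy
      subst hyx
      simp only at h3
      obtain ⟨w, hw⟩ : ∃ w, (annotations s.ctx)[x - 1]? = some w :=
        ⟨_, List.getElem?_eq_getElem (by simp [h]; omega)⟩
      refine ⟨w, ⟨h1, hw⟩, h1, ?_⟩
      rw [← hw, h, h']
      simp only [List.append_assoc]
      rcases h3 with h3 | h3
      · rw [List.getElem?_append_left (by omega), List.getElem?_append_left (by omega)]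
      · obtain ⟨m, rfl⟩ : ∃ m, x = L.length + 2 + m + 1 := ⟨x - (L.length + 3), by omega⟩
        rw [List.getElem?_append_right (l₁ := L) (by omega),
          List.getElem?_append_right (l₁ := L) (by omega)]
        rw [show L.length + 2 + m + 1 - 1 - L.length = m + 2 by omega]
        simp
    · simp only [Set.mem_insert_iff, Set.mem_singleton_iff, Prod.mk.injEq, true_and] at hxy
      rcases hxy with ⟨rfl, rfl⟩ | ⟨rfl, rfl⟩
      · refine ⟨u, ⟨by omega, ?_⟩, by omega, ?_⟩ <;> simp [h, h']
      · refine ⟨v, ⟨by omega, ?_⟩, by omega, ?_⟩ <;> simp [h, h']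
  · rintro x y (⟨⟨-, -, h3, -⟩, -⟩ | hxy)
    · cases h3
    · simp at hxy
  · rintro y w ⟨h1, h2⟩ -
    have h3 := (List.getElem?_eq_some_iff.1 h2).1
    rw [h'] at h3
    simp only [List.length_append, List.length_cons, List.length_nil] at h3
    by_cases h4 : y = L.length + 1
    · exact ⟨L.length + 2, false, .inr (by simp [h4])⟩
    by_cases h5 : y = L.length + 2
    · exact ⟨L.length + 1, false, .inr (by simp [h5])⟩
    · exact ⟨y, false, .inl ⟨⟨h1, by simp only; omega, rfl, rfl⟩, by simp only; omega⟩⟩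

theorem transfer_ctr {s s' : RawSeq} {L : List (List ℕ)} {u : List ℕ}
    (h : annotations s.ctx = L ++ [u]) (h' : annotations s'.ctx = L ++ [u, u])
    (hc : s'.ctrl = s.ctrl) :
    Transfer s s' (CGT.idUpTo (L.length + 1) ∪ {(L.length + 1, false, L.length + 2)}) := by
  refine ⟨?_, ?_, ?_, fun _ => .inl hc⟩
  · rintro x y (hxy | hxy)
    · obtain ⟨h1, h2, -, hyx⟩ := mem_idUpTo.1 hxy
      subst hyx
      obtain ⟨w, hw⟩ : ∃ w, (annotations s.ctx)[x - 1]? = some w :=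
        ⟨_, List.getElem?_eq_getElem (by simp [h]; omega)⟩
      refine ⟨w, ⟨h1, hw⟩, h1, ?_⟩
      rw [h', ← List.singleton_append, ← List.append_assoc, ← h,
        List.getElem?_append_left (by simp [h]; omega), hw]
    · simp only [Set.mem_singleton_iff, Prod.mk.injEq, true_and] at hxy
      obtain ⟨rfl, rfl⟩ := hxy
      refine ⟨u, ⟨by omega, ?_⟩, by omega, ?_⟩ <;> simp [h, h']
  · rintro x y (⟨-, -, h3, -⟩ | hxy)
    · cases h3
    · simp at hxy
  · rintro y w ⟨h1, h2⟩ -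
    have h3 := (List.getElem?_eq_some_iff.1 h2).1
    rw [h'] at h3
    simp only [List.length_append, List.length_cons, List.length_nil] at h3
    rcases lt_or_ge (L.length + 1) y with h4 | h4
    · obtain rfl : y = L.length + 2 := by omega
      exact ⟨L.length + 1, false, .inr rfl⟩
    · exact ⟨y, false, .inl ⟨h1, h4, rfl, rfl⟩⟩

/-- Every rule of reset Gödel's T other than `Reset` changes annotations along the traces of the underlying
rule. -/
theorem RawRule.Legal.transfer {R : RawRule} (hR : R.Legal) {r : CGT.Rule} (hr : R.erase = some r)
    (i : ℕ) (hi : i < R.prems.length) :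
    Transfer R.concl R.prems[i] (CGT.traceMap r i) := by
  cases R with
  | id => simp [prems] at hi
  | zero => simp [prems] at hi
  | succ => simp [prems] at hi
  | reset => simp [erase] at hr
  | left Θ Γ A B u C =>
    cases hr
    -- The rule hands `u` over to `B`, which may be `N` and has no predecessor; this is harmless
    -- because an arrow type carries no letters.
    have hu : u = [] := hR.concl_wf.only_N (.arr A B, u) (by simp [concl]) (by simp)
    have hn : CGT.traceMap (.left (Γ.map Prod.fst) A B C) i =
        CGT.idUpTo (annotations Γ).length := by
      simp [CGT.traceMap, CGT.Rule.concl, ← numN_map_fst, CGT.numN]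
    rw [hn]
    have h0 : annotations (Γ ++ [(.arr A B, u)]) = annotations Γ ++ [] := by
      rw [annotations_append, annotations_cons_of_ne (by simp), annotations_nil]
    obtain rfl | rfl : i = 0 ∨ i = 1 := by simp [prems] at hi; omega
    · exact transfer_idUpTo (L₂ := []) h0 (by simp [prems]) (by simp) (.inr rfl)
    · refine transfer_idUpTo (L₂ := annotations [(B, u)]) h0 (annotations_append _ _) ?_ (.inl rfl)
      by_cases hB : B = .N <;> simp [annotations, hB, hu]
  | right Θ Γ A B =>
    cases hr
    obtain rfl : i = 0 := by simp [prems] at hi; omega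
    have hn : CGT.traceMap (.right (Γ.map Prod.fst) A B) 0 =
        CGT.idUpTo (annotations Γ).length := by
      simp [CGT.traceMap, CGT.Rule.concl, ← numN_map_fst]
    rw [hn]
    refine transfer_idUpTo (L₁ := []) (L₂ := annotations [(A, [])]) (by simp [concl])
      (annotations_append _ _) ?_ (.inl rfl)
    by_cases hA : A = .N <;> simp [annotations, hA]
  | cut Θ Γ B A =>
    cases hr
    have hn : CGT.traceMap (.cut (Γ.map Prod.fst) B A) i =
        CGT.idUpTo (annotations Γ).length := by
      simp [CGT.traceMap, CGT.Rule.concl, ← numN_map_fst]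
    rw [hn]
    obtain rfl | rfl : i = 0 ∨ i = 1 := by simp [prems] at hi; omega
    · exact transfer_idUpTo (L₁ := []) (L₂ := []) (by simp [concl]) (by simp [prems]) (by simp)
        (.inl rfl)
    · refine transfer_idUpTo (L₁ := []) (L₂ := annotations [(B, [])]) (by simp [concl])
        (annotations_append _ _) ?_ (.inl rfl)
      by_cases hB : B = .N <;> simp [annotations, hB]
  | cond Θ Γ u a A =>
    cases hr
    have hk : CGT.numN (Γ.map Prod.fst ++ [Ty.N]) = (annotations Γ).length + 1 := by
      simp [← numN_map_fst, CGT.numN]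
    have h0 : annotations (Γ ++ [(.N, u)]) = annotations Γ ++ [u] := by
      rw [annotations_append, annotations_cons_N, annotations_nil]
    obtain rfl | rfl : i = 0 ∨ i = 1 := by simp [prems] at hi; omega
    · have hn : CGT.traceMap (.cond (Γ.map Prod.fst) A) 0 =
          CGT.idUpTo (annotations Γ).length := by
        simp [CGT.traceMap, hk]
      rw [hn]
      exact transfer_idUpTo (L₂ := []) h0 (by simp [prems]) (by simp) (.inr rfl)
    · have hn : CGT.traceMap (.cond (Γ.map Prod.fst) A) 1 =
          CGT.idUpTo (annotations Γ).length ∪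
            {((annotations Γ).length + 1, true, (annotations Γ).length + 1)} := by
        simp [CGT.traceMap, hk]
      rw [hn]
      exact transfer_cond h0 (by simp [prems, annotations_append, annotations_cons_N,
        annotations_nil]) hR.side rfl
  | ex Θ Γ A v B u Γ' C =>
    cases hr
    obtain rfl : i = 0 := by simp [prems] at hi; omega
    have hn : CGT.numN (Γ.map Prod.fst ++ [B, A] ++ Γ'.map Prod.fst) =
        (annotations (Γ ++ [(B, u), (A, v)] ++ Γ')).length := by
      simp [← numN_map_fst]
    by_cases hAB : A = .N ∧ B = .N
    · obtain ⟨rfl, rfl⟩ := hAB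
      simp only [CGT.traceMap, hn, and_self, if_true, numN_map_fst]
      refine transfer_ex (u := u) (v := v) (L' := annotations Γ') ?_ ?_ ?_ rfl <;>
      simp [concl, prems, annotations_append, annotations_cons_N]
      omega
    -- Unless both types are `N`, the exchange leaves the sequence of occurrences of `N` unchanged.
    · simp only [CGT.traceMap, hn, if_neg hAB]
      refine transfer_idUpTo (L₁ := []) (L₂ := []) (by simp [concl]) ?_ (by simp) (.inl rfl)
      simp only [prems, List.getElem_cons_zero, annotations_append, List.append_nil]
      congr 2
      by_cases hA : A = .N
      · have hB : B ≠ .N := fun hB => hAB ⟨hA, hB⟩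
        simp [annotations, hA, hB]
      · by_cases hB : B = .N <;> simp [annotations, hA, hB]
  | wk Θ Γ A u B =>
    cases hr
    obtain rfl : i = 0 := by simp [prems] at hi; omega
    have hn : CGT.traceMap (.wk (Γ.map Prod.fst) A B) 0 =
        CGT.idUpTo (annotations Γ).length := by
      simp only [CGT.traceMap, ← numN_map_fst]
      split_ifs with hA <;> simp [CGT.numN, hA]
    rw [hn]
    exact transfer_idUpTo (L₂ := []) (annotations_append _ _) (by simp [prems]) (by simp) (.inr rfl)
  | ctr Θ Γ A u B =>
    cases hr
    obtain rfl : i = 0 := by simp [prems] at hi; omega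
    by_cases hA : A = .N
    · subst hA
      have hk : CGT.numN (Γ.map Prod.fst ++ [Ty.N]) = (annotations Γ).length + 1 := by
        simp [← numN_map_fst, CGT.numN]
      simp only [CGT.traceMap, hk, if_true]
      refine transfer_ctr (u := u) ?_ ?_ rfl <;>
      simp [concl, prems, annotations_append, annotations_cons_N, annotations_nil]
    · have hk : CGT.numN (Γ.map Prod.fst ++ [A]) = (annotations Γ).length := by
        simp [← numN_map_fst, CGT.numN, hA]
      simp only [CGT.traceMap, hk, if_neg hA]
      refine transfer_idUpTo (L₁ := []) (L₂ := []) ?_ ?_ (by simp) (.inl rfl) <;>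
      simp [concl, prems, annotations_append, annotations_cons_of_ne hA, annotations_nil]

/-! ### The rules of the reset system -/

theorem RawRule.erase_concl {R : RawRule} {r : CGT.Rule} (hr : R.erase = some r) :
    r.concl = ⟨R.concl.ctx.map Prod.fst, R.concl.ty⟩ := by
  cases R <;> cases hr <;> simp [concl, CGT.Rule.concl]

theorem RawRule.erase_prems {R : RawRule} {r : CGT.Rule} (hr : R.erase = some r) :
    r.prems = R.prems.map fun s => ⟨s.ctx.map Prod.fst, s.ty⟩ := by
  cases R <;> cases hr <;> simp [prems, CGT.Rule.prems]

/-- The annotations in the conclusion of `Reset` containing the letter which is reset. -/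
theorem ann_concl_reset {Θ : List ℕ} {Γ : Ctx} {u : List ℕ} {a : ℕ} {us : List (List ℕ)} {B : Ty}
    (hR : (RawRule.reset Θ Γ u a us B).Legal) {i : ℕ} {v : List ℕ}
    (hv : Ann (RawRule.reset Θ Γ u a us B).concl.ctx i v) (hav : a ∈ v) :
    ∃ w ∈ us, v = u ++ a :: w := by
  obtain ⟨p, hp, rfl⟩ := hv.exists_mem
  rw [RawRule.concl, List.mem_append] at hp
  rcases hp with hp | hp
  · exact absurd hav (hR.side.2.2 p hp)
  · obtain ⟨w, hw, rfl⟩ := List.mem_map.1 hp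
    exact ⟨w, hw, rfl⟩

/-- How `Reset` changes annotations. -/
theorem ann_prem_reset {Θ : List ℕ} {Γ : Ctx} {u : List ℕ} {a : ℕ} {us : List (List ℕ)} {B : Ty}
    (hR : (RawRule.reset Θ Γ u a us B).Legal) (i : ℕ) :
    (∀ v, Ann (RawRule.reset Θ Γ u a us B).concl.ctx i v →
      Ann (Γ ++ us.map fun _ => (Ty.N, u ++ [a])) i (if a ∈ v then u ++ [a] else v)) ∧
    ∀ v', Ann (Γ ++ us.map fun _ => (Ty.N, u ++ [a])) i v' →
      ∃ v, Ann (RawRule.reset Θ Γ u a us B).concl.ctx i v := by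
  have hann : ∀ L : List (List ℕ), annotations (L.map fun w => (Ty.N, w)) = L := by
    intro L
    simp [annotations, List.filter_map, Function.comp_def]
  have h0 : annotations (RawRule.reset Θ Γ u a us B).concl.ctx =
      annotations Γ ++ us.map (fun w => u ++ a :: w) := by
    have := hann (us.map fun w => u ++ a :: w)
    rw [List.map_map] at this
    rw [RawRule.concl, annotations_append, ← this]
    rfl
  have h1 : annotations (Γ ++ us.map (fun _ => (Ty.N, u ++ [a]))) =
      annotations Γ ++ us.map (fun _ => u ++ [a]) := by
    have := hann (us.map fun w => u ++ [a])
    rw [List.map_map] at this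
    rw [annotations_append, ← this]
    rfl
  have haΓ := hR.side.2.2
  simp only [Ann, h0, h1]
  constructor
  · rintro v ⟨hi, hv⟩
    refine ⟨hi, ?_⟩
    rcases lt_or_ge (i - 1) (annotations Γ).length with h2 | h2
    · rw [List.getElem?_append_left h2] at hv ⊢
      obtain ⟨p, hp, rfl⟩ := Ann.exists_mem (Γ := Γ) ⟨hi, hv⟩
      rw [if_neg (haΓ p hp), hv]
    · rw [List.getElem?_append_right h2] at hv ⊢
      simp only [List.getElem?_map, Option.map_eq_some_iff] at hv ⊢
      obtain ⟨w, hw, rfl⟩ := hv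
      exact ⟨w, hw, by simp⟩
  · rintro v ⟨hi, hv⟩
    have := (List.getElem?_eq_some_iff.1 hv).1
    exact ⟨_, hi, List.getElem?_eq_getElem (by simpa using this)⟩

/-- The order of letters in an annotation is the order of the control, so in `u ++ a :: w` the chips
above `a` are those of `w`. Removing them leaves `u ++ [a]`, and `a` is covered because every `w` is
nonempty. Since `a` does not occur in `Γ`, no other stack changes. -/
theorem isReset_embedBoard {Θ : List ℕ} {Γ : Ctx} {u : List ℕ} {a : ℕ} {us : List (List ℕ)} {B : Ty}
    (hR : (RawRule.reset Θ Γ u a us B).Legal) :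
    (embedBoard (RawRule.reset Θ Γ u a us B).concl).IsReset a
      (embedBoard ⟨clean Θ (Γ ++ us.map (fun _ => (.N, u ++ [a]))),
        Γ ++ us.map (fun _ => (.N, u ++ [a])), B⟩) := by
  classical
  obtain ⟨hus, hne, -⟩ := hR.side
  have hwf := hR.concl_wf
  set s := (RawRule.reset Θ Γ u a us B).concl with hs
  set Γ' : Ctx := Γ ++ us.map (fun _ => (Ty.N, u ++ [a])) with hΓ'
  have hsub : ∀ i v, Ann s.ctx i v → v.Sublist (embedBoard s).ctrl := by
    intro i v hv
    obtain ⟨p, hp, rfl⟩ := hv.exists_mem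
    have : p.2.filter (fun γ => decide (∃ p ∈ s.ctx, γ ∈ p.2)) = p.2 := by
      rw [List.filter_eq_self]
      exact fun γ hγ => decide_eq_true ⟨p, hp, hγ⟩
    rw [← this]
    exact (hwf.sublist p hp).filter _
  have hnd : (embedBoard s).ctrl.Nodup := (embedBoard_isOn s hwf).nodup
  have hle : ∀ i w, Ann s.ctx i (u ++ a :: w) →
      (∀ x ∈ u, (embedBoard s).le x a) ∧ ∀ x ∈ w, ¬ (embedBoard s).le x a := by
    intro i w hv
    have h2 := hsub _ _ hv
    have hP : (embedBoard s).ctrl.Pairwise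
        fun x y => (embedBoard s).ctrl.idxOf x < (embedBoard s).ctrl.idxOf y := by
      rw [List.pairwise_iff_getElem]
      intro i j hi hj hij
      rwa [hnd.idxOf_getElem, hnd.idxOf_getElem]
    have h3 := hP.sublist h2
    rw [List.pairwise_append, List.pairwise_cons] at h3
    exact ⟨fun x hx => (h3.2.2 x hx a (by simp)).le, fun x hx => not_le.2 (h3.2.1.1 x hx)⟩
  have hcases := fun i v (hv : Ann s.ctx i v) (hav : a ∈ v) => ann_concl_reset hR hv hav
  have hreset : ∀ i v, Ann s.ctx i v → (embedBoard s).resetStack a v.toFinset =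
      if a ∈ v then (u ++ [a]).toFinset else v.toFinset := by
    intro i v hv
    simp only [Board.resetStack, List.mem_toFinset]
    split_ifs with hav
    · obtain ⟨w, hw, rfl⟩ := hcases i v hv hav
      obtain ⟨h2, h3⟩ := hle i w hv
      ext x
      simp only [Finset.mem_filter, List.mem_toFinset, List.mem_append, List.mem_cons,
        List.not_mem_nil, or_false]
      constructor
      · rintro ⟨h4 | h4 | h4, h5⟩
        · exact .inl h4
        · exact .inr h4
        · exact absurd h5 (h3 x h4)
      · rintro (h4 | rfl)
        · exact ⟨.inl h4, h2 x h4⟩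
        · exact ⟨.inr (.inl rfl), le_refl _⟩
    · rfl
  have hpos := ann_prem_reset hR
  have hstk : ∀ x c, (embedBoard ⟨clean Θ Γ', Γ', B⟩).stk x c =
      (embedBoard s).resetStack a '' (embedBoard s).stk x c := by
    intro x c
    ext S
    simp only [Set.mem_image, mem_embedBoard_stk]
    constructor
    · rintro ⟨hc, v', hv', rfl⟩
      obtain ⟨v, hv⟩ := (hpos x).2 v' hv'
      refine ⟨v.toFinset, ⟨hc, v, hv, rfl⟩, ?_⟩
      rw [hreset x v hv, hv'.unique ((hpos x).1 v hv)]
      split_ifs <;> rfl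
    · rintro ⟨_, ⟨hc, v, hv, rfl⟩, rfl⟩
      refine ⟨hc, _, (hpos x).1 v hv, ?_⟩
      rw [hreset x v hv]
      split_ifs <;> rfl
  have hwf' := hR.prems_wf ⟨clean Θ Γ', Γ', B⟩ (by simp [RawRule.prems, hΓ'])
  refine ⟨⟨?_, ?_⟩, hstk, ?_⟩
  · obtain ⟨w, hw⟩ := List.exists_mem_of_ne_nil us hus
    have hp : (Ty.N, u ++ a :: w) ∈ s.ctx :=
      List.mem_append_right _ (List.mem_map.2 ⟨w, hw, rfl⟩)
    exact mem_clean.2 ⟨(hwf.sublist _ hp).subset (by simp), _, hp, by simp⟩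
  · rintro x c S hS ⟨haS, hS'⟩
    obtain ⟨-, v, hv, rfl⟩ := mem_embedBoard_stk.1 hS
    obtain ⟨w, hw, rfl⟩ := hcases x v hv (by simpa using haS)
    obtain ⟨b, hb⟩ := List.exists_mem_of_ne_nil w (hne w hw)
    exact (hle x w hv).2 b hb (hS' b (by simp [hb]))
  · change clean (clean Θ Γ') Γ' = (clean Θ s.ctx).filter _
    rw [clean_clean]
    refine clean_eq_filter fun γ hγ => ?_
    rw [@decide_eq_true_iff _ _]
    have h2 := hwf'.exists_mem_iff (γ := γ)
    have h3 := hwf.exists_mem_iff (γ := γ)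
    simp only at h2
    rw [h2, h3]
    constructor
    · rintro ⟨i, v', hv', hγv'⟩
      obtain ⟨v, hv⟩ := (hpos i).2 v' hv'
      refine ⟨⟨i, false, v'.toFinset, mem_embedBoard_stk.2 ⟨rfl, v', hv', rfl⟩, by simpa⟩,
        i, v, hv, ?_⟩
      rw [hv'.unique ((hpos i).1 v hv)] at hγv'
      split_ifs at hγv' with hav
      · obtain ⟨w, hw, rfl⟩ := hcases i v hv hav
        rw [List.append_cons]
        exact List.mem_append_left _ hγv'
      · exact hγv'
    · rintro ⟨⟨x, c, S, hS, hγS⟩, -⟩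
      obtain ⟨-, v, hv, rfl⟩ := mem_embedBoard_stk.1 hS
      exact ⟨x, v, hv, by simpa using hγS⟩

/-- A rule of the reset system which applies the rule corresponding to `R` to the image of its
conclusion; `Pop` leads from its premises to the images of the premises of `R`. -/
structure Represents (Q : CGT.interp.RRule) (R : Rule) : Prop where
  concl : Q.concl = embedSeq (deriv.concl R)
  base : Q.base = R.1.erase
  chip : Q.chip = R.1.letter
  length : Q.prems.length = (deriv.prems R).length
  seq : ∀ i (h : i < Q.prems.length),
    (embedSeq ((deriv.prems R)[i]'(length ▸ h))).seq = Q.prems[i].seq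
  pop : ∀ i (h : i < Q.prems.length),
    Q.prems[i].board.IsPopulation (embedSeq ((deriv.prems R)[i]'(length ▸ h))).board

/-- For rules with a counterpart the premises carry the boards `succBoard`, which Pop completes to
the images. For Reset the premise is already the image of the premise. -/
theorem exists_represents (R : Rule) : ∃ Q, Represents Q R := by
  obtain ⟨R, hR⟩ := R
  rcases hr : R.erase with _ | r
  · cases R with
    | reset Θ Γ u a us B =>
      refine ⟨.reset a (embedSeq ⟨_, hR.concl_wf⟩)
        (embedSeq ⟨_, hR.prems_wf _ (by simp [RawRule.prems])⟩) ?_ (isReset_embedBoard hR),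
        ⟨rfl, rfl, rfl, rfl, ?_, ?_⟩⟩
      · simp [embedSeq, RawRule.concl, Function.comp_def]
        rfl
      · intro i h
        obtain rfl : i = 0 := by simpa [TraceInterp.RRule.prems] using h
        rfl
      · intro i h
        obtain rfl : i = 0 := by simpa [TraceInterp.RRule.prems] using h
        -- Every board is a population of itself.
        exact ⟨rfl, fun x => ⟨fun S hS => hS, fun S hS => .inl hS⟩, fun _ _ _ => rfl⟩
    | _ => cases hr
  · have hT := hR.transfer hr
    have hWF : ∀ i (hi : i < R.prems.length), R.prems[i].WF :=
      fun i hi => hR.prems_wf _ (List.getElem_mem hi)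
    let ps : List CGT.interp.RSeq := List.ofFn fun i : Fin R.prems.length =>
      { seq := ⟨R.prems[i].ctx.map Prod.fst, R.prems[i].ty⟩
        board := succBoard R.prems[i] (CGT.traceMap r i)
        isOn := (hT i i.2).isOn (hWF i i.2) }
    refine ⟨.lift r (embedSeq ⟨_, hR.concl_wf⟩) ps ?_ ?_ ?_, ⟨rfl, hr.symm, ?_, ?_, ?_, ?_⟩⟩
    · exact (RawRule.erase_concl hr).symm
    · exact (List.map_ofFn.trans (List.ofFn_getElem_eq_map R.prems
        fun s => (⟨s.ctx.map Prod.fst, s.ty⟩ : CGT.Seq))).trans (RawRule.erase_prems hr).symm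
    · intro i hi
      have hi' : i < R.prems.length := by simpa [ps] using hi
      have := (hT i hi').isSuccessor hR.concl_wf (hWF i hi')
      simp only [ps, List.getElem_ofFn]
      exact this
    · cases R <;> first | rfl | cases hr
    · simp [ps, TraceInterp.RRule.prems, deriv]
    · intro i h
      simp [ps, TraceInterp.RRule.prems, deriv, embedSeq]
      rfl
    · intro i h
      have hi' : i < R.prems.length := by simpa [ps, TraceInterp.RRule.prems] using h
      simpa [ps, TraceInterp.RRule.prems, deriv, embedSeq] using (hT i hi').isPopulation

/-! ### The embedding -/

/-- The rule of the reset system corresponding to `R`. -/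
noncomputable def image (R : Rule) : CGT.interp.RRule := (exists_represents R).choose

theorem image_spec (R : Rule) : Represents (image R) R := (exists_represents R).choose_spec

theorem lt_of_lt_image {R : Rule} {i : ℕ} (h : i < (CGT.interp.resetDeriv.prems (image R)).length) :
    i < (deriv.prems R).length := (image_spec R).length ▸ h

/-- The application of `Pop` above the `i`-th premise of the image of `R`. It adds the empty stack of a new
occurrence of `N`; if there is none, it leaves the board unchanged. -/
noncomputable def popRule (R : Rule)
    (i : Fin (CGT.interp.resetDeriv.prems (image R)).length) : CGT.interp.RRule :=
  .pop ((image R).prems[i]'i.2) (embedSeq ((deriv.prems R)[i]'(lt_of_lt_image i.2)))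
    ((image_spec R).seq i i.2) ((image_spec R).pop i i.2)

/-- Pop is applied above every premise, even where it changes nothing, so that each node of the
source contributes exactly two levels and heights simply double. -/
noncomputable def embedRule (R : Rule) : Preproof CGT.interp.resetDeriv :=
  .infer (D := CGT.interp.resetDeriv) (image R) fun i =>
    .infer (D := CGT.interp.resetDeriv) (popRule R i) fun _ =>
      .hyp (embedSeq ((deriv.prems R)[i]'(lt_of_lt_image i.2)))

theorem fin_popRule {R : Rule} {i} (j : Fin (CGT.interp.resetDeriv.prems (popRule R i)).length) :
    j = ⟨0, Nat.one_pos⟩ := by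
  have : j.1 < 1 := j.2
  ext
  simp only
  omega

noncomputable def embed : PreproofMorphism deriv CGT.interp.resetDeriv where
  onSeq := embedSeq
  onRule := embedRule
  isPreproof R := fun i => ⟨rfl, fun j => ⟨by rw [fin_popRule j]; rfl, trivial⟩⟩
  endseq_eq R := (image_spec R).concl
  assumptions_eq R := by
    have h : ∀ (l : List Seq) (n : ℕ) (hn : n = l.length),
        (List.ofFn fun i : Fin n => [embedSeq (l[i]'(hn ▸ i.2))]).flatten = l.map embedSeq := by
      rintro l _ rfl
      refine (congrArg List.flatten
        (List.ofFn_getElem_eq_map l fun s => [embedSeq s])).trans ?_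
      induction l with
      | nil => rfl
      | cons a l ih => simpa using ih
    exact h _ _ (image_spec R).length

theorem corresponds_embedRule (R : Rule) : Corresponds R (embedRule R) :=
  ⟨image R, _, rfl, (image_spec R).base, (image_spec R).chip, fun i =>
    .inr ⟨popRule R i, _, rfl, trivial, fun _ => trivial⟩⟩

/-- The image of a preproof under `embed`: every rule is replaced by its image, followed by `Pop`. -/
noncomputable def embedProof : Preproof deriv → Preproof CGT.interp.resetDeriv
  | .hyp Γ => .hyp (D := CGT.interp.resetDeriv) (embedSeq Γ)
  -- The distance `k + 1` to the companion doubles to `2 * k + 2`.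
  | .bud Γ k => .bud (D := CGT.interp.resetDeriv) (embedSeq Γ) (2 * k + 1)
  | .infer R cs => .infer (D := CGT.interp.resetDeriv) (image R) fun i =>
      .infer (D := CGT.interp.resetDeriv) (popRule R i) fun _ =>
        embedProof (cs ⟨i, lt_of_lt_image i.2⟩)

theorem endseq_embedProof (P : Preproof deriv) : (embedProof P).endseq = embedSeq P.endseq := by
  cases P with
  | hyp Γ => rfl
  | bud Γ k => rfl
  | infer R cs => exact (image_spec R).concl

/-- Each premise contributes exactly one open leaf, so the number of leaves to its left is the index
of the premise; the leaf sits above the rule and its Pop, hence at height `d + 2`. -/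
theorem plug_embedRule (R : Rule) (g : ℕ → ℕ → Preproof CGT.interp.resetDeriv) (d : ℕ) :
    (embedRule R).plug g 0 d = .infer (D := CGT.interp.resetDeriv) (image R) fun i =>
      .infer (D := CGT.interp.resetDeriv) (popRule R i) fun _ => g i (d + 2) := by
  change Preproof.infer (D := CGT.interp.resetDeriv) (image R) (fun i =>
    .infer (D := CGT.interp.resetDeriv) (popRule R i) fun j => g _ _) = _
  congr 1
  funext i
  congr 1
  funext j
  rw [fin_popRule j]
  congr 1
  have h1 : ∀ n m : ℕ, m ≤ n → ((List.ofFn fun _ : Fin n => 1).take m).sum = m := by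
    intro n m hm
    rw [List.ofFn_const, List.take_replicate, List.sum_replicate]
    simpa using hm
  change 0 + ((List.ofFn fun _ : Fin _ => 1).take i.1).sum + (List.take 0 _).sum = i.1
  rw [h1 _ _ i.2.le]
  simp

/-- With doubled heights, the environment at source height `n` is `2 * (n - 1), …, 2, 0`. Companions
are therefore always strictly below, and no bud is left open. -/
theorem mapAt_embed (P : Preproof deriv) (below : List deriv.Seq) (h : P.Correct below) :
    embed.mapAt P ((List.range below.length).reverse.map (2 * ·)) (2 * below.length) =
      embedProof P := by
  induction P generalizing below with
  | hyp Γ => rfl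
  | bud Γ k =>
    have hk : k < below.length := (List.getElem?_eq_some_iff.1 h).1
    have : ((List.range below.length).reverse.map (2 * ·))[k]? =
        some (2 * (below.length - 1 - k)) := by
      rw [List.getElem?_map, List.getElem?_reverse (by simpa using hk)]
      rw [List.getElem?_range (by simp; omega)]
      simp
    simp only [PreproofMorphism.mapAt, this, embedProof]
    rw [if_pos (by omega)]
    congr 1
    omega
  | infer R cs ih =>
    rw [PreproofMorphism.mapAt]
    refine (plug_embedRule R _ _).trans ?_
    rw [embedProof]
    congr 1
    funext i
    congr 1
    funext _
    rw [dif_pos (lt_of_lt_image i.2)]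
    rw [← ih ⟨i, lt_of_lt_image i.2⟩ (deriv.concl R :: below) (h ⟨i, lt_of_lt_image i.2⟩).2]
    congr 1
    simp [List.range_succ]

theorem map_embed {P : Preproof deriv} (h : P.IsPreproof) : embed.map P = embedProof P :=
  mapAt_embed P [] h

/-! ### Nodes and labelling of the embedded preproof. -/

/-- The position of the image of a node. -/
def double (t : List ℕ) : List ℕ := t.flatMap fun i => [i, 0]

theorem double_cons (i : ℕ) (t : List ℕ) : double (i :: t) = i :: 0 :: double t := rfl

theorem double_append (s t : List ℕ) : double (s ++ t) = double s ++ double t := by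
  simp [double]

theorem length_double (t : List ℕ) : (double t).length = 2 * t.length := by
  simp [double, mul_comm]

theorem double_take (t : List ℕ) (n : ℕ) : double (t.take n) = (double t).take (2 * n) := by
  induction t generalizing n with
  | nil => simp [double]
  | cons i t ih =>
    cases n with
    | zero => simp [double]
    | succ n => simp [double_cons, ih, Nat.mul_succ]

theorem companion_double {t : List ℕ} {k : ℕ} :
    Preproof.companion (double t) (2 * k + 1) = double (Preproof.companion t k) := by
  rw [Preproof.companion, Preproof.companion, double_take, length_double]
  congr 1
  omega

theorem double_prefix_iff {s t : List ℕ} : double s <+: double t ↔ s <+: t := by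
  constructor
  · intro h
    induction s generalizing t with
    | nil => exact List.nil_prefix
    | cons i s ih =>
      cases t with
      | nil => simp [double] at h
      | cons j t =>
        simp only [double_cons, List.cons_prefix_cons] at h
        exact List.cons_prefix_cons.2 ⟨h.1, ih h.2.2⟩
  · rintro ⟨w, rfl⟩
    exact ⟨double w, (double_append s w).symm⟩

theorem sub_embedProof {P Q : Preproof deriv} {t : List ℕ} (h : P.sub t = some Q) :
    (embedProof P).sub (double t) = some (embedProof Q) := by
  induction t generalizing P with
  | nil => simp at h; simp [double, h]
  | cons i t ih =>
    obtain ⟨R, cs, hi, rfl, h'⟩ := Preproof.sub_cons_eq_some.1 h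
    have hi' : i < (CGT.interp.resetDeriv.prems (image R)).length :=
      lt_of_lt_of_eq hi (image_spec R).length.symm
    rw [double_cons, embedProof]
    exact (Preproof.sub_infer_cons hi').trans ((Preproof.sub_infer_cons
      (D := CGT.interp.resetDeriv) (R := popRule R ⟨i, hi'⟩) Nat.one_pos).trans (ih h'))

/-- Nodes at even height are images of nodes, those at odd height are the inserted Pop nodes. -/
theorem exists_of_sub_embedProof {P : Preproof deriv} {t' : List ℕ}
    {Q' : Preproof CGT.interp.resetDeriv} (h : (embedProof P).sub t' = some Q') :
    (∃ t Q, t' = double t ∧ P.sub t = some Q ∧ Q' = embedProof Q) ∨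
    ∃ t R cs, ∃ i : Fin (CGT.interp.resetDeriv.prems (image R)).length,
      t' = double t ++ [i.1] ∧ P.sub t = some (.infer R cs) ∧
      Q' = .infer (D := CGT.interp.resetDeriv) (popRule R i) fun _ =>
        embedProof (cs ⟨i, lt_of_lt_image i.2⟩) := by
  induction P generalizing t' Q' with
  | hyp Γ =>
    cases t' with
    | nil => exact .inl ⟨[], .hyp Γ, rfl, rfl, by simpa using h.symm⟩
    | cons i t' => simp [embedProof, Preproof.sub] at h
  | bud Γ k =>
    cases t' with
    | nil => exact .inl ⟨[], .bud Γ k, rfl, rfl, by simpa using h.symm⟩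
    | cons i t' => simp [embedProof, Preproof.sub] at h
  | infer R cs ih =>
    cases t' with
    | nil => exact .inl ⟨[], .infer R cs, rfl, rfl, by simpa using h.symm⟩
    | cons i t' =>
      obtain ⟨R', cs', hi, he, h'⟩ := Preproof.sub_cons_eq_some.1 h
      rw [embedProof] at he
      cases he
      cases t' with
      | nil => exact .inr ⟨[], R, cs, ⟨i, hi⟩, rfl, by simp, by simpa using h'.symm⟩
      | cons j t' =>
        obtain ⟨R', cs', hj, he, h''⟩ := Preproof.sub_cons_eq_some.1 h'
        cases he
        obtain rfl : j = 0 := by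
          have : j < 1 := hj
          omega
        rcases ih _ h'' with ⟨t, Q, rfl, h1, h2⟩ | ⟨t, R₁, cs₁, l, rfl, h1, h2⟩
        · exact .inl ⟨i :: t, Q, rfl, by rwa [Preproof.sub_infer_cons (lt_of_lt_image hi)], h2⟩
        · exact .inr ⟨i :: t, R₁, cs₁, l, rfl,
            by rwa [Preproof.sub_infer_cons (lt_of_lt_image hi)], h2⟩

theorem isPreproof_embedProof {P : Preproof deriv} (h : P.IsPreproof) :
    (embedProof P).IsPreproof := by
  rw [Preproof.isPreproof_iff] at h ⊢
  constructor
  · intro t' Q cs' ht i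
    rcases exists_of_sub_embedProof ht with ⟨t, Q', rfl, h1, h2⟩ | ⟨t, R, cs, j, rfl, h1, h2⟩
    · cases Q' with
      | infer R cs =>
        rw [embedProof] at h2
        cases h2
        rfl
      | _ => cases h2
    · cases h2
      have h3 := h.child t R cs h1 ⟨j, lt_of_lt_image j.2⟩
      rw [endseq_embedProof, h3, fin_popRule i]
      rfl
  · intro t' Γ' k' ht
    rcases exists_of_sub_embedProof ht with ⟨t, Q', rfl, h1, h2⟩ | ⟨t, R, cs, j, rfl, h1, h2⟩
    · cases Q' with
      | bud Γ k =>
        cases h2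
        obtain ⟨hk, Q, hQ, hΓ⟩ := h.bud t Γ k h1
        refine ⟨by rw [length_double]; omega, embedProof Q, ?_, ?_⟩
        · rw [companion_double]
          exact sub_embedProof hQ
        · rw [endseq_embedProof, hΓ]
      | _ => cases h2
    · cases h2

theorem assumptions_embedProof {P : Preproof deriv} (h : P.assumptions = []) :
    (embedProof P).assumptions = [] := by
  rw [Preproof.assumptions_eq_nil_iff] at h ⊢
  intro t' Γ' ht
  rcases exists_of_sub_embedProof ht with ⟨t, Q', rfl, h1, h2⟩ | ⟨t, R, cs, j, rfl, h1, h2⟩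
  · cases Q' with
    | hyp Γ => exact h t Γ h1
    | _ => cases h2
  · cases h2

/-! ### Invariants -/

/-- A letter of the control which occurs in the context of a premise occurs in the context of the
conclusion. -/
theorem RawRule.Legal.exists_mem_of_prems {R : RawRule} (hR : R.Legal) {s : RawSeq} (hs : s ∈ R.prems)
    {γ : ℕ} (hγ : γ ∈ R.concl.ctrl) (h : ∃ p ∈ s.ctx, γ ∈ p.2) : ∃ p ∈ R.concl.ctx, γ ∈ p.2 := by
  obtain ⟨i, hi, rfl⟩ := List.getElem_of_mem hs
  rcases hr : R.erase with _ | r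
  · cases R with
    | reset Θ Γ u a us B =>
      obtain rfl : i = 0 := by simpa [prems] using hi
      obtain ⟨p, hp, hγp⟩ := h
      simp only [prems, List.getElem_cons_zero, List.mem_append, List.mem_map] at hp
      rcases hp with hp | ⟨w, hw, rfl⟩
      · exact ⟨p, List.mem_append_left _ hp, hγp⟩
      · refine ⟨(.N, u ++ a :: w), List.mem_append_right _ (List.mem_map.2 ⟨w, hw, rfl⟩), ?_⟩
        rw [List.append_cons]
        exact List.mem_append_left _ hγp
    | _ => cases hr
  · exact (((hR.transfer hr i hi).exists_mem_iff hR.concl_wf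
      (hR.prems_wf _ (List.getElem_mem hi)) hγ).1 h).2

/-- Descend from `s ++ w` to `s`, applying `RawRule.Legal.exists_mem_of_prems` at each rule. The
letter must be in all controls on the way, since otherwise it could be the fresh letter of a Cond.
-/
theorem exists_mem_of_append {P Q Q' : Preproof deriv} (hP : P.WellLabelled) {s w : List ℕ} {γ : ℕ}
    (hs : P.sub s = some Q) (hw : P.sub (s ++ w) = some Q')
    (hγ : ∀ v Q₁, v <+: w → P.sub (s ++ v) = some Q₁ → γ ∈ Q₁.endseq.1.ctrl)
    (h : ∃ p ∈ Q'.endseq.1.ctx, γ ∈ p.2) : ∃ p ∈ Q.endseq.1.ctx, γ ∈ p.2 := by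
  induction w using List.reverseRecOn generalizing Q' with
  | nil =>
    rw [List.append_nil, hs] at hw
    cases hw
    exact h
  | append_singleton w i ih =>
    rw [← List.append_assoc] at hw
    obtain ⟨R, cs, hi, h1, rfl⟩ := Preproof.sub_snoc.1 hw
    refine ih h1 (fun v Q₁ hv => hγ v Q₁ (hv.trans (List.prefix_append _ _))) ?_
    rw [hP.child _ R cs h1 ⟨i, hi⟩] at h
    refine R.2.exists_mem_of_prems (s := ((deriv.prems R).get ⟨i, hi⟩).1) ?_
      (hγ w _ (List.prefix_append _ _) h1) h
    simp [deriv]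

/-- Cleaning may delete letters of the invariant word `u`, but it deletes the same ones at all nodes
between companion and bud, so the filtered word is a common prefix. The letter `a` survives because
it occurs where it is reset. -/
theorem hasInvariants_embedProof {P : Preproof deriv} (hP : P.IsPreproof)
    (h : P.HasInvariants (D := deriv) (fun s => s.1.ctrl) (fun R => R.1.letter)) :
    (embedProof P).HasInvariants (D := CGT.interp.resetDeriv)
      (fun s => (TraceInterp.RSeq.board s).ctrl) TraceInterp.RRule.chip := by
  classical
  rw [Preproof.isPreproof_iff] at hP
  intro t' Γ' k' ht
  rcases exists_of_sub_embedProof ht with ⟨t, Q', rfl, h1, h2⟩ | ⟨t, R, cs, j, rfl, h1, h2⟩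
  swap
  · cases h2
  cases Q' with
  | hyp => cases h2
  | infer => cases h2
  | bud Γ k =>
  cases h2
  obtain ⟨u, a, hu, s₀, R₀, cs₀, h3, h4, h5, h6⟩ := h t Γ k h1
  obtain ⟨hk, Qc, hQc, hΓ⟩ := hP.bud t Γ k h1
  -- a letter of `u` or `a` occurs everywhere between companion and bud or nowhere
  have hmem : ∀ s Q, Preproof.companion t k <+: s → s <+: t → P.sub s = some Q →
      ∀ γ ∈ u ++ [a], (∃ p ∈ Q.endseq.1.ctx, γ ∈ p.2) ↔ ∃ p ∈ Γ.1.ctx, γ ∈ p.2 := by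
    intro s Q hcs hst hQ γ hγ
    constructor
    · intro h7
      obtain ⟨w, rfl⟩ := hcs
      rw [← hΓ]
      refine exists_mem_of_append hP hQc hQ (fun v Q₁ hv hQ₁ => ?_) h7
      exact (hu _ Q₁ (List.prefix_append _ _)
        (((List.prefix_append_right_inj _).2 hv).trans hst) hQ₁).subset hγ
    · intro h7
      obtain ⟨w, rfl⟩ := hst
      refine exists_mem_of_append hP hQ h1 (fun v Q₁ hv hQ₁ => ?_) h7
      exact (hu _ Q₁ (hcs.trans (List.prefix_append _ _))
        ((List.prefix_append_right_inj _).2 hv) hQ₁).subset hγ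
  have ha : ∃ p ∈ Γ.1.ctx, a ∈ p.2 := by
    rw [← hmem s₀ _ h3 h4 h5 a (by simp)]
    obtain ⟨R₀, hR₀⟩ := R₀
    cases R₀ with
    | reset Θ Δ v b us B =>
      cases h6
      obtain ⟨w, hw⟩ := List.exists_mem_of_ne_nil us hR₀.side.1
      exact ⟨(.N, v ++ a :: w), List.mem_append_right _ (List.mem_map.2 ⟨w, hw, rfl⟩), by simp⟩
    | _ => cases h6
  have hctrl : ∀ s Q, Preproof.companion t k <+: s → s <+: t → P.sub s = some Q →
      u.filter (fun γ => ∃ p ∈ Γ.1.ctx, γ ∈ p.2) ++ [a] <+: (embedSeq Q.endseq).board.ctrl := by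
    intro s Q hcs hst hQ
    have h8 : (u ++ [a]).filter (fun γ => ∃ p ∈ Q.endseq.1.ctx, γ ∈ p.2) =
        (u ++ [a]).filter (fun γ => ∃ p ∈ Γ.1.ctx, γ ∈ p.2) :=
      List.filter_congr fun γ hγ => by
        rw [Bool.eq_iff_iff, decide_eq_true_iff, decide_eq_true_iff]
        exact hmem s Q hcs hst hQ γ hγ
    have h9 : (u ++ [a]).filter (fun γ => ∃ p ∈ Γ.1.ctx, γ ∈ p.2) =
        u.filter (fun γ => ∃ p ∈ Γ.1.ctx, γ ∈ p.2) ++ [a] := by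
      rw [List.filter_append]
      congr 1
      simpa using ha
    change _ <+: clean Q.endseq.1.ctrl Q.endseq.1.ctx
    rw [← h9, ← h8]
    exact (hu s Q hcs hst hQ).filter _
  refine ⟨u.filter (fun γ => ∃ p ∈ Γ.1.ctx, γ ∈ p.2), a, ?_, ?_⟩
  · intro s' Q' hcs hst hQ
    rw [companion_double] at hcs
    rcases exists_of_sub_embedProof hQ with ⟨s, Q, rfl, h7, rfl⟩ | ⟨s, R, cs, j, rfl, h7, rfl⟩
    · rw [endseq_embedProof]
      exact hctrl s Q (double_prefix_iff.1 hcs) (double_prefix_iff.1 hst) h7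
    · have hsub : P.sub (s ++ [j.1]) = some (cs ⟨j, lt_of_lt_image j.2⟩) :=
        Preproof.sub_snoc.2 ⟨R, cs, lt_of_lt_image j.2, h7, rfl⟩
      -- The position of the bud has even length, so a path through a Pop node continues to the
      -- child above it. Pop leaves the control unchanged, and the invariant can be read off at that
      -- child.
      have hst' : s ++ [j.1] <+: t := by
        obtain ⟨w, rfl⟩ : s <+: t := double_prefix_iff.1 ((List.prefix_append _ _).trans hst)
        rw [double_append, List.prefix_append_right_inj] at hst
        rw [List.prefix_append_right_inj]
        cases w with
        | nil => simp [double] at hst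
        | cons i w =>
          simp only [double_cons, List.cons_prefix_cons, List.nil_prefix, and_true] at hst
          simp [hst]
      have hcs' : Preproof.companion t k <+: s ++ [j.1] := by
        refine double_prefix_iff.1 ?_
        rw [double_append]
        exact hcs.trans ⟨[0], by simp [double]⟩
      have h8 := hctrl _ _ hcs' hst' hsub
      rw [hP.child s R cs h7 ⟨j, lt_of_lt_image j.2⟩] at h8
      exact (((image_spec R).pop j j.2).1 ▸ h8 : _)
  · refine ⟨double s₀, image R₀, _, ?_, double_prefix_iff.2 h4, sub_embedProof h5, ?_⟩
    · rw [companion_double]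
      exact double_prefix_iff.2 h3
    · exact (image_spec R₀).chip.trans h6

theorem isProofMorphism_embed :
    PreproofMorphism.IsProofMorphism (D := sys) (E := CGT.interp.resetSys) embed := by
  rintro P ⟨h1, h2, h3⟩
  have h4 : embed.map P = embedProof P := map_embed h1
  change embed.map P ∈ _
  rw [h4]
  exact ⟨isPreproof_embedProof h1, assumptions_embedProof h2, hasInvariants_embedProof h1 h3⟩

open TraceInterp

/-! ### Removing boards and resets -/

theorem mapAt_strip_of_base {Q : CGT.interp.RRule} {r : CGT.Rule} (h : Q.base = some r)
    (cs : Fin (CGT.interp.resetDeriv.prems Q).length → Preproof CGT.interp.resetDeriv)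
    (env : List ℕ) (d : ℕ) :
    ∃ hl : (CGT.deriv.prems r).length = (CGT.interp.resetDeriv.prems Q).length,
      CGT.interp.strip.mapAt (.infer (D := CGT.interp.resetDeriv) Q cs) env d =
        .infer (D := CGT.deriv) r fun i =>
          CGT.interp.strip.mapAt (cs ⟨i, hl ▸ i.2⟩) (d :: env) (d + 1) := by
  cases Q with
  | lift R c ps hc hps hi =>
    cases h
    have hl : (CGT.deriv.prems r).length =
        (CGT.interp.resetDeriv.prems (.lift r c ps hc hps hi)).length := by
      rw [← hps, List.length_map]
      rfl
    refine ⟨hl, ?_⟩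
    change Preproof.infer (D := CGT.deriv) r (fun i => dite _ _ _) = _
    congr 1
    funext i
    have h1 : ∀ n m : ℕ, m ≤ n → 0 + ((List.ofFn fun _ : Fin n => 1).take m).sum = m := by
      intro n m hm
      rw [List.ofFn_const, List.take_replicate, List.sum_replicate]
      simpa using hm
    have h2 := h1 _ i.1 i.2.le
    rw [dif_pos (by exact h2.symm ▸ hl ▸ i.2)]
    congr 2
    exact Fin.ext h2
  | _ => cases h

/-- A structural rule is sent to a bare open leaf, so its premise is translated at the same height
`d`; the environment nevertheless records the removed node. -/
theorem mapAt_strip_of_none {Q : CGT.interp.RRule} (h : Q.base = none)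
    (cs : Fin (CGT.interp.resetDeriv.prems Q).length → Preproof CGT.interp.resetDeriv)
    (env : List ℕ) (d : ℕ) :
    ∃ h0 : 0 < (CGT.interp.resetDeriv.prems Q).length,
      CGT.interp.strip.mapAt (.infer (D := CGT.interp.resetDeriv) Q cs) env d =
        CGT.interp.strip.mapAt (cs ⟨0, h0⟩) (d :: env) d := by
  cases Q with
  | lift R c ps hc hps hi => cases h
  | _ =>
    exact ⟨Nat.one_pos, rfl⟩

/-- The preproof of cyclic Gödel's T underlying a preproof, as a subtree of the whole translation. -/
noncomputable def stripAt (P : Preproof deriv) (env : List ℕ) (d : ℕ) : Preproof CGT.deriv :=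
  CGT.interp.strip.mapAt (embedProof P) env d

/-- Two heights enter the environment: `d` for the rule and `d + 1` for the Pop above it, which
disappears. -/
theorem stripAt_infer {R : deriv.Rule} {r : CGT.Rule} (hr : R.1.erase = some r)
    (cs : Fin (deriv.prems R).length → Preproof deriv) (env : List ℕ) (d : ℕ) :
    ∃ hl : (CGT.deriv.prems r).length = (deriv.prems R).length,
      stripAt (.infer R cs) env d = .infer (D := CGT.deriv) r fun i =>
        stripAt (cs ⟨i, hl ▸ i.2⟩) ((d + 1) :: d :: env) (d + 1) := by
  obtain ⟨hl, h⟩ := mapAt_strip_of_base ((image_spec R).base.trans hr) (fun i =>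
    .infer (D := CGT.interp.resetDeriv) (popRule R i) fun _ =>
      embedProof (cs ⟨i, lt_of_lt_image i.2⟩)) env d
  refine ⟨hl.trans (image_spec R).length, ?_⟩
  exact h

theorem stripAt_reset {R : deriv.Rule} (hr : R.1.erase = none)
    (cs : Fin (deriv.prems R).length → Preproof deriv) (env : List ℕ) (d : ℕ) :
    ∃ h0 : 0 < (deriv.prems R).length,
      stripAt (.infer R cs) env d = stripAt (cs ⟨0, h0⟩) (d :: d :: env) d := by
  obtain ⟨h0, h⟩ := mapAt_strip_of_none ((image_spec R).base.trans hr) (fun i =>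
    .infer (D := CGT.interp.resetDeriv) (popRule R i) fun _ =>
      embedProof (cs ⟨i, lt_of_lt_image i.2⟩)) env d
  refine ⟨lt_of_lt_image h0, ?_⟩
  exact Eq.trans h (mapAt_strip_of_none (Q := popRule R _) rfl _ _ _).2

theorem stripAt_bud (Γ : deriv.Seq) (k : ℕ) (env : List ℕ) (d : ℕ) :
    stripAt (.bud Γ k) env d = match env[2 * k + 1]? with
      | some e => if e < d then .bud (D := CGT.deriv) (embedSeq Γ).seq (d - e - 1)
          else .hyp (D := CGT.deriv) (embedSeq Γ).seq
      | none => .hyp (D := CGT.deriv) (embedSeq Γ).seq := rfl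

theorem length_prems_of_erase_none {R : deriv.Rule} (hr : R.1.erase = none) :
    (deriv.prems R).length = 1 := by
  obtain ⟨R, hR⟩ := R
  cases R <;> first | rfl | cases hr

/-- The position in the translation corresponding to a position: steps at resets are dropped. -/
def pos : Preproof deriv → List ℕ → List ℕ
  | .infer R cs, i :: t =>
      if h : i < (deriv.prems R).length then
        match R.1.erase with
        | none => pos (cs ⟨i, h⟩) t
        | some _ => i :: pos (cs ⟨i, h⟩) t
      else []
  | _, _ => []

theorem pos_nil (P : Preproof deriv) : pos P [] = [] := by
  cases P <;> rfl

theorem pos_cons_of_some {R : deriv.Rule} {r : CGT.Rule} (hr : R.1.erase = some r)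
    {cs : Fin (deriv.prems R).length → Preproof deriv} {i : ℕ} (hi : i < (deriv.prems R).length)
    (t : List ℕ) : pos (.infer R cs) (i :: t) = i :: pos (cs ⟨i, hi⟩) t := by
  rw [pos, dif_pos hi]
  split <;> simp_all

theorem pos_cons_of_none {R : deriv.Rule} (hr : R.1.erase = none)
    {cs : Fin (deriv.prems R).length → Preproof deriv} {i : ℕ} (hi : i < (deriv.prems R).length)
    (t : List ℕ) : pos (.infer R cs) (i :: t) = pos (cs ⟨i, hi⟩) t := by
  rw [pos, dif_pos hi]
  split <;> simp_all

theorem pos_append {P Q : Preproof deriv} {s : List ℕ} (w : List ℕ) (h : P.sub s = some Q) :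
    pos P (s ++ w) = pos P s ++ pos Q w := by
  induction s generalizing P with
  | nil => simp at h; simp [h, pos_nil]
  | cons i s ih =>
    obtain ⟨R, cs, hi, rfl, h'⟩ := Preproof.sub_cons_eq_some.1 h
    rcases hr : R.1.erase with _ | r
    · rw [List.cons_append, pos_cons_of_none hr hi, pos_cons_of_none hr hi, ih h']
    · rw [List.cons_append, pos_cons_of_some hr hi, pos_cons_of_some hr hi, ih h', List.cons_append]

theorem pos_snoc_of_some {P : Preproof deriv} {s : List ℕ} {R : deriv.Rule} {r : CGT.Rule}
    (hr : R.1.erase = some r) {cs : Fin (deriv.prems R).length → Preproof deriv}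
    (h : P.sub s = some (.infer R cs)) {i : ℕ} (hi : i < (deriv.prems R).length) :
    pos P (s ++ [i]) = pos P s ++ [i] := by
  rw [pos_append _ h, pos_cons_of_some hr hi, pos_nil]

theorem pos_snoc_of_none {P : Preproof deriv} {s : List ℕ} {R : deriv.Rule}
    (hr : R.1.erase = none) {cs : Fin (deriv.prems R).length → Preproof deriv}
    (h : P.sub s = some (.infer R cs)) {i : ℕ} (hi : i < (deriv.prems R).length) :
    pos P (s ++ [i]) = pos P s := by
  rw [pos_append _ h, pos_cons_of_none hr hi, pos_nil, List.append_nil]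

/-- Every level of the source pushes two heights, that of the rule and in front of it that of its
Pop. So index `2 * k + 1` belongs to the ancestor `k + 1` levels down, and the old environment
starts at index `2 * t.length`. -/
theorem sub_stripAt {P Q : Preproof deriv} {t : List ℕ} (h : P.sub t = some Q) (env : List ℕ)
    (d : ℕ) : ∃ env' : List ℕ,
      (stripAt P env d).sub (pos P t) = some (stripAt Q env' (d + (pos P t).length)) ∧
      (∀ k < t.length, env'[2 * k + 1]? = some (d + (pos P (Preproof.companion t k)).length)) ∧
      ∀ j : ℕ, env'[2 * t.length + j]? = env[j]? := by
  induction t generalizing P env d with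
  | nil =>
    simp at h
    exact ⟨env, by simp [h, pos_nil], by simp, by simp⟩
  | cons i t ih =>
    obtain ⟨R, cs, hi, rfl, h'⟩ := Preproof.sub_cons_eq_some.1 h
    rcases hr : R.1.erase with _ | r
    · obtain ⟨h0, hS⟩ := stripAt_reset hr cs env d
      obtain rfl : i = 0 := by
        have := length_prems_of_erase_none hr
        omega
      obtain ⟨env', h1, h2, h3⟩ := ih h' (d :: d :: env) d
      refine ⟨env', ?_, fun k hk => ?_, fun j => ?_⟩
      · rw [pos_cons_of_none hr hi, hS, h1]
      · rcases (Nat.lt_succ_iff.1 hk).eq_or_lt with rfl | hk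
        · rw [h3 1]
          simp [Preproof.companion, pos_nil]
        · rw [h2 k hk, Preproof.companion_cons hk, pos_cons_of_none hr hi]
      · rw [List.length_cons, show 2 * (t.length + 1) + j = 2 * t.length + (j + 2) by ring, h3]
        rfl
    · obtain ⟨hl, hS⟩ := stripAt_infer hr cs env d
      obtain ⟨env', h1, h2, h3⟩ := ih h' ((d + 1) :: d :: env) (d + 1)
      refine ⟨env', ?_, fun k hk => ?_, fun j => ?_⟩
      · rw [pos_cons_of_some hr hi, hS]
        refine (Preproof.sub_infer_cons (D := CGT.deriv) (hl ▸ hi)).trans ?_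
        rw [h1, List.length_cons]
        congr 2
        ring
      · rcases (Nat.lt_succ_iff.1 hk).eq_or_lt with rfl | hk
        · rw [h3 1]
          simp [Preproof.companion, pos_nil]
        · rw [h2 k hk, Preproof.companion_cons hk, pos_cons_of_some hr hi, List.length_cons]
          congr 1
          ring
      · rw [List.length_cons, show 2 * (t.length + 1) + j = 2 * t.length + (j + 2) by ring, h3]
        rfl

/-! ### Cycles contain rules other than resets -/

/-- The total length of all annotations. -/
def weight (Γ : Ctx) : ℕ := (Γ.map fun p => p.2.length).sum

/-- Reset cuts a nonempty tail off at least one annotation, thanks to both conditions `us ≠ []` and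
`w ≠ []`. -/
theorem weight_lt_of_erase_none {R : RawRule} (hR : R.Legal) (hr : R.erase = none) {s : RawSeq}
    (hs : s ∈ R.prems) : weight s.ctx < weight R.concl.ctx := by
  cases R with
  | reset Θ Γ u a us B =>
    obtain ⟨hus, hne, -⟩ := hR.side
    obtain rfl : s = _ := List.mem_singleton.1 hs
    simp only [weight, RawRule.concl, List.map_append, List.map_map, List.sum_append,
      add_lt_add_iff_left]
    refine List.sum_lt_sum_of_ne_nil hus _ _ fun w hw => ?_
    have := List.length_pos_iff.2 (hne w hw)
    simp
    omega
  | _ => cases hr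

/-- If the position does not grow, all rules applied between the two nodes are resets, and each
lowers the weight. -/
theorem weight_lt_of_pos_eq {P Q Q' : Preproof deriv} (hP : P.WellLabelled) {s w : List ℕ}
    (hw : w ≠ []) (hs : P.sub s = some Q) (hsw : P.sub (s ++ w) = some Q')
    (h : (pos P (s ++ w)).length ≤ (pos P s).length) :
    weight Q'.endseq.1.ctx < weight Q.endseq.1.ctx := by
  induction w using List.reverseRecOn generalizing Q' with
  | nil => exact absurd rfl hw
  | append_singleton w i ih =>
    rw [← List.append_assoc] at hsw h
    obtain ⟨R, cs, hi, h1, rfl⟩ := Preproof.sub_snoc.1 hsw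
    have h2 : (pos P s).length ≤ (pos P (s ++ w)).length := by
      rw [pos_append _ hs, List.length_append]
      omega
    rcases hr : R.1.erase with _ | r
    · rw [pos_snoc_of_none hr h1 hi] at h
      have h3 : weight (cs ⟨i, hi⟩).endseq.1.ctx < weight R.1.concl.ctx := by
        rw [hP.child _ R cs h1 ⟨i, hi⟩]
        exact weight_lt_of_erase_none R.2 hr (s := ((deriv.prems R).get ⟨i, hi⟩).1) (by simp [deriv])
      rcases eq_or_ne w [] with rfl | hw
      · rw [List.append_nil, hs] at h1
        cases h1
        exact h3
      · exact h3.trans (ih hw h1 h)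
    · rw [pos_snoc_of_some hr h1 hi, List.length_append, List.length_singleton] at h
      omega

/-! ### The nodes of the translation -/

/-- Only the labelling of children is assumed, not that of buds, because the lemma is applied to
subtrees, whose buds may point outside. -/
theorem endseq_stripAt {P : Preproof deriv} (hP : ∀ t R cs, P.sub t = some (.infer R cs) →
    ∀ i, (cs i).endseq = (deriv.prems R).get i) (env : List ℕ) (d : ℕ) :
    (stripAt P env d).endseq = (embedSeq P.endseq).seq := by
  induction P generalizing env d with
  | hyp Γ => rfl
  | bud Γ k =>
    rw [stripAt_bud]
    split
    · split <;> rfl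
    · rfl
  | infer R cs ih =>
    rcases hr : R.1.erase with _ | r
    · obtain ⟨h0, hS⟩ := stripAt_reset hr cs env d
      rw [hS, ih ⟨0, h0⟩ (fun t R' cs' ht => hP (0 :: t) R' cs' (by
        rwa [Preproof.sub_infer_cons h0])), hP [] R cs (Preproof.sub_nil _) ⟨0, h0⟩]
      obtain ⟨R, hR⟩ := R
      cases R with
      | reset Θ Γ u a us B =>
        simp [deriv, embedSeq, Preproof.endseq, RawRule.concl, RawRule.prems, Function.comp_def]
        rfl
      | _ => cases hr
    · obtain ⟨hl, hS⟩ := stripAt_infer hr cs env d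
      rw [hS]
      exact RawRule.erase_concl hr

/-- The translation of a whole preproof. -/
noncomputable def stripped (P : Preproof deriv) : Preproof CGT.deriv := stripAt P [] 0

section

variable {P : Preproof deriv}

theorem exists_sub_stripped (hP : P.WellLabelled) {t : List ℕ} {Q : Preproof deriv}
    (h : P.sub t = some Q) :
    ∃ Q', (stripped P).sub (pos P t) = some Q' ∧ Q'.endseq = (embedSeq Q.endseq).seq := by
  obtain ⟨env', h1, -⟩ := sub_stripAt h [] 0
  refine ⟨_, h1, endseq_stripAt (fun s R cs hs => hP.child (t ++ s) R cs ?_) _ _⟩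
  rw [Preproof.sub_append _ h, hs]

theorem sub_stripped_infer {t : List ℕ} {R : deriv.Rule} {r : CGT.Rule} (hr : R.1.erase = some r)
    {cs : Fin (deriv.prems R).length → Preproof deriv} (h : P.sub t = some (.infer R cs)) :
    (CGT.deriv.prems r).length = (deriv.prems R).length ∧
      ∃ cs', (stripped P).sub (pos P t) = some (.infer (D := CGT.deriv) r cs') := by
  obtain ⟨env', h1, -⟩ := sub_stripAt h [] 0
  obtain ⟨hl, hS⟩ := stripAt_infer hr cs env' (0 + (pos P t).length)
  exact ⟨hl, _, h1.trans (congrArg some hS)⟩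

/-- The bud could fail to stay strictly above its companion only if all rules in between were
resets. Then the weight would strictly decrease from companion to bud, although both carry the same
sequent. -/
theorem sub_stripped_bud (hP : P.WellLabelled) {t : List ℕ} {Γ : deriv.Seq} {k : ℕ}
    (h : P.sub t = some (.bud Γ k)) :
    ∃ k', (stripped P).sub (pos P t) = some (.bud (D := CGT.deriv) (embedSeq Γ).seq k') ∧
      k' < (pos P t).length ∧
      Preproof.companion (pos P t) k' = pos P (Preproof.companion t k) := by
  obtain ⟨env', h1, h2, -⟩ := sub_stripAt h [] 0
  obtain ⟨hk, Q, hQ, hΓ⟩ := hP.bud t Γ k h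
  obtain ⟨w, hw⟩ := Preproof.companion_prefix t k
  have hpos : pos P t = pos P (Preproof.companion t k) ++ pos Q w := by
    rw [← pos_append w hQ, hw]
  have hlt : (pos P (Preproof.companion t k)).length < (pos P t).length := by
    by_contra hlt
    rw [not_lt] at hlt
    have hne : w ≠ [] := by
      rintro rfl
      have := congrArg List.length hw
      rw [List.append_nil, Preproof.length_companion] at this
      omega
    have := weight_lt_of_pos_eq hP hne hQ (Q' := .bud Γ k) (by rwa [hw]) (by rwa [hw])
    rw [hΓ] at this
    exact lt_irrefl _ this
  refine ⟨(pos P t).length - (pos P (Preproof.companion t k)).length - 1, ?_, by omega, ?_⟩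
  · rw [stripped, h1, stripAt_bud, h2 k hk]
    simp only [Nat.zero_add, if_pos hlt]
  · rw [Preproof.companion, show (pos P t).length - ((pos P t).length -
      (pos P (Preproof.companion t k)).length - 1 + 1) = (pos P (Preproof.companion t k)).length by
      omega]
    conv_lhs => rw [hpos]
    simp

/-- Skipping resets. -/
theorem exists_skip {Q : Preproof deriv} {t : List ℕ} (h : P.sub t = some Q) :
    ∃ t' Q', P.sub t' = some Q' ∧ pos P t' = pos P t ∧
      (∀ R cs, Q' = .infer R cs → R.1.erase ≠ none) ∧
      ∀ p r, P.Reads (fun R : Rule => R.1.erase) t' p r →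
        P.Reads (fun R : Rule => R.1.erase) t p r := by
  induction Q generalizing t with
  | hyp Γ => exact ⟨t, _, h, rfl, by simp, fun _ _ => id⟩
  | bud Γ k => exact ⟨t, _, h, rfl, by simp, fun _ _ => id⟩
  | infer R cs ih =>
    rcases hr : R.1.erase with _ | r
    · have h0 : 0 < (deriv.prems R).length := by rw [length_prems_of_erase_none hr]; exact one_pos
      obtain ⟨t', Q', h1, h2, h3, h4⟩ := ih ⟨0, h0⟩ (Preproof.sub_snoc.2 ⟨R, cs, h0, h, rfl⟩)
      exact ⟨t', Q', h1, h2.trans (pos_snoc_of_none hr h h0), h3,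
        fun p r hp => .skip h hr (h4 p r hp)⟩
    · refine ⟨t, _, h, rfl, ?_, fun _ _ => id⟩
      rintro R' cs' he
      cases he
      simp [hr]

/-- Every node of the translation is the translation of a node which is not a reset. -/
theorem exists_of_sub_stripped (hP : P.WellLabelled) (hc : P.assumptions = []) {t' : List ℕ}
    {S : Preproof CGT.deriv} (h : (stripped P).sub t' = some S) :
    ∃ t, pos P t = t' ∧ ((∃ R cs r, R.1.erase = some r ∧ P.sub t = some (.infer R cs)) ∨
      ∃ Γ k, P.sub t = some (.bud Γ k)) := by
  rw [Preproof.assumptions_eq_nil_iff] at hc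
  have key : ∀ t Q, P.sub t = some Q → ∃ t₁, pos P t₁ = pos P t ∧
      ((∃ R cs r, R.1.erase = some r ∧ P.sub t₁ = some (.infer R cs)) ∨
        ∃ Γ k, P.sub t₁ = some (.bud Γ k)) := by
    intro t Q ht
    obtain ⟨t₁, Q₁, h1, h2, h3, -⟩ := exists_skip ht
    refine ⟨t₁, h2, ?_⟩
    cases Q₁ with
    | hyp Γ => exact absurd h1 (hc t₁ Γ)
    | bud Γ k => exact .inr ⟨Γ, k, h1⟩
    | infer R cs =>
      obtain ⟨r, hr⟩ := Option.ne_none_iff_exists'.1 (h3 R cs rfl)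
      exact .inl ⟨R, cs, r, hr, h1⟩
  induction t' using List.reverseRecOn generalizing S with
  | nil =>
    obtain ⟨t₁, h1, h2⟩ := key [] P (Preproof.sub_nil P)
    exact ⟨t₁, by rw [h1, pos_nil], h2⟩
  | append_singleton t' i ih =>
    obtain ⟨r, cs', hi, h1, rfl⟩ := Preproof.sub_snoc.1 h
    obtain ⟨t, rfl, ⟨R, cs, r', hr, ht⟩ | ⟨Γ, k, ht⟩⟩ := ih h1
    · obtain ⟨hl, cs'', h2⟩ := sub_stripped_infer hr ht
      rw [h1] at h2
      cases h2
      have hi' : i < (deriv.prems R).length := hl ▸ hi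
      obtain ⟨t₁, h3, h4⟩ := key (t ++ [i]) _ (Preproof.sub_snoc.2 ⟨R, cs, hi', ht, rfl⟩)
      exact ⟨t₁, by rw [h3, pos_snoc_of_some hr ht hi'], h4⟩
    · obtain ⟨k', h2, -⟩ := sub_stripped_bud hP ht
      rw [h1] at h2
      cases h2

theorem isPreproof_stripped (h : P.IsPreproof) (hc : P.assumptions = []) :
    (stripped P).IsPreproof := by
  rw [Preproof.isPreproof_iff] at h ⊢
  constructor
  · intro t' r cs' ht i
    obtain ⟨t, rfl, ⟨R, cs, r', hr, ht'⟩ | ⟨Γ, k, ht'⟩⟩ := exists_of_sub_stripped h hc ht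
    · obtain ⟨hl, cs'', h2⟩ := sub_stripped_infer hr ht'
      rw [ht] at h2
      cases h2
      have hi : i.1 < (deriv.prems R).length := hl ▸ i.2
      obtain ⟨Q', h3, h4⟩ := exists_sub_stripped h (Preproof.sub_snoc.2 ⟨R, cs, hi, ht', rfl⟩)
      rw [pos_snoc_of_some hr ht' hi] at h3
      obtain ⟨r₁, cs₁, hi₁, h5, h6⟩ := Preproof.sub_snoc.1 h3
      rw [ht] at h5
      cases h5
      rw [← h6, h4, h.child t R cs ht' ⟨i, hi⟩]
      -- The equation between lists of premises is used entrywise; with a variable `l` it can be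
      -- substituted despite the dependent index bounds.
      have h7 : ∀ (l : List CGT.Seq) (hl : l = R.1.prems.map fun s =>
          ⟨s.ctx.map Prod.fst, s.ty⟩) (j : ℕ) (hj : j < l.length),
          l[j] = ⟨(R.1.prems[j]'(by simpa [hl] using hj)).ctx.map Prod.fst,
            (R.1.prems[j]'(by simpa [hl] using hj)).ty⟩ := by
        rintro l rfl j hj
        simp
      refine Eq.trans ?_ (h7 _ (RawRule.erase_prems hr) i.1 i.2).symm
      simp [deriv, embedSeq]
      rfl
    · obtain ⟨k', h2, -⟩ := sub_stripped_bud h ht'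
      rw [ht] at h2
      cases h2
  · intro t' Γ' k' ht
    obtain ⟨t, rfl, ⟨R, cs, r', hr, ht'⟩ | ⟨Γ, k, ht'⟩⟩ := exists_of_sub_stripped h hc ht
    · obtain ⟨hl, cs'', h2⟩ := sub_stripped_infer hr ht'
      rw [ht] at h2
      cases h2
    · obtain ⟨k'', h2, h3, h4⟩ := sub_stripped_bud h ht'
      rw [ht] at h2
      cases h2
      obtain ⟨hk, Q, hQ, hΓ⟩ := h.bud t Γ k ht'
      obtain ⟨Q', h5, h6⟩ := exists_sub_stripped h hQ
      exact ⟨h3, Q', h4 ▸ h5, by rw [h6, hΓ]⟩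

theorem assumptions_stripped (h : P.WellLabelled) (hc : P.assumptions = []) :
    (stripped P).assumptions = [] := by
  rw [Preproof.assumptions_eq_nil_iff]
  intro t' Γ' ht
  obtain ⟨t, rfl, ⟨R, cs, r', hr, ht'⟩ | ⟨Γ, k, ht'⟩⟩ := exists_of_sub_stripped h hc ht
  · obtain ⟨hl, cs'', h2⟩ := sub_stripped_infer hr ht'
    rw [ht] at h2
    cases h2
  · obtain ⟨k'', h2, -⟩ := sub_stripped_bud h ht'
    rw [ht] at h2
    cases h2

/-! ### Computational content -/

theorem _root_.CyclicGT.Preproof.Reads.exists_sub {D : DerivSys} {α : Type} {er : D.Rule → Option α}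
    {P : Preproof D} {t p : List ℕ} {r : α} (h : P.Reads er t p r) : ∃ Q, P.sub t = some Q := by
  cases h <;> exact ⟨_, by assumption⟩

theorem reads_stripped (hP : P.WellLabelled) {t p : List ℕ} {r : CGT.Rule}
    (h : P.Reads (fun R : Rule => R.1.erase) t p r) :
    (stripped P).Reads (fun R : CGT.Rule => some R) (pos P t) p r := by
  induction h with
  | here h1 h2 =>
    obtain ⟨-, cs', h3⟩ := sub_stripped_infer h2 h1
    exact .here h3 rfl
  | child h1 h2 h3 ih =>
    obtain ⟨-, cs', h4⟩ := sub_stripped_infer h2 h1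
    obtain ⟨Q, hQ⟩ := h3.exists_sub
    obtain ⟨R₁, cs₁, hi, h5, -⟩ := Preproof.sub_snoc.1 hQ
    rw [h1] at h5
    cases h5
    rw [pos_snoc_of_some h2 h1 hi] at ih
    exact .child h4 rfl ih
  | skip h1 h2 h3 ih =>
    obtain ⟨Q, hQ⟩ := h3.exists_sub
    obtain ⟨R₁, cs₁, hi, h5, -⟩ := Preproof.sub_snoc.1 hQ
    rw [h1] at h5
    cases h5
    rwa [pos_snoc_of_none h2 h1 hi] at ih
  | jump h1 h2 ih =>
    obtain ⟨k', h3, -, h4⟩ := sub_stripped_bud hP h1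
    exact .jump h3 (h4 ▸ ih)

/-- A node of the translation may come from several nodes, a chain of resets and the node above it,
so the claim is proved for all of them. Each case first skips the resets by `exists_skip`. -/
theorem reads_of_stripped (hP : P.WellLabelled) (hc : P.assumptions = []) {t' p : List ℕ}
    {r : CGT.Rule} (h : (stripped P).Reads (fun R : CGT.Rule => some R) t' p r) :
    ∀ t Q, P.sub t = some Q → pos P t = t' → P.Reads (fun R : Rule => R.1.erase) t p r := by
  rw [Preproof.assumptions_eq_nil_iff] at hc
  induction h with
  | @here t' R' cs' r' h1 h2 =>
    intro t Q ht hpos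
    obtain ⟨t₁, Q₁, h3, h4, h5, h6⟩ := exists_skip ht
    refine h6 _ _ ?_
    rw [hpos] at h4
    cases Q₁ with
    | hyp Γ => exact absurd h3 (hc t₁ Γ)
    | bud Γ k =>
      obtain ⟨k', h7, -⟩ := sub_stripped_bud hP h3
      rw [h4, h1] at h7
      cases h7
    | infer R cs =>
      obtain ⟨r, hr⟩ := Option.ne_none_iff_exists'.1 (h5 R cs rfl)
      obtain ⟨-, cs'', h7⟩ := sub_stripped_infer hr h3
      rw [h4, h1] at h7
      cases h7
      cases h2
      exact .here h3 hr
  | @child t' R' cs' r' i p r'' h1 h2 h3 ih =>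
    intro t Q ht hpos
    obtain ⟨t₁, Q₁, h8, h4, h5, h6⟩ := exists_skip ht
    refine h6 _ _ ?_
    rw [hpos] at h4
    cases Q₁ with
    | hyp Γ => exact absurd h8 (hc t₁ Γ)
    | bud Γ k =>
      obtain ⟨k', h7, -⟩ := sub_stripped_bud hP h8
      rw [h4, h1] at h7
      cases h7
    | infer R cs =>
      obtain ⟨r, hr⟩ := Option.ne_none_iff_exists'.1 (h5 R cs rfl)
      obtain ⟨hl, cs'', h7⟩ := sub_stripped_infer hr h8
      rw [h4, h1] at h7
      cases h7
      obtain ⟨Q', hQ'⟩ := h3.exists_sub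
      obtain ⟨R₁, cs₁, hi, h9, -⟩ := Preproof.sub_snoc.1 hQ'
      rw [h1] at h9
      cases h9
      have hi' : i < (deriv.prems R).length := hl ▸ hi
      exact .child h8 hr (ih _ _ (Preproof.sub_snoc.2 ⟨R, cs, hi', h8, rfl⟩)
        (by rw [pos_snoc_of_some hr h8 hi', h4]))
  | skip h1 h2 => cases h2
  | @jump t' Γ' k' p r' h1 h2 ih =>
    intro t Q ht hpos
    obtain ⟨t₁, Q₁, h3, h4, h5, h6⟩ := exists_skip ht
    refine h6 _ _ ?_
    rw [hpos] at h4
    cases Q₁ with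
    | hyp Γ => exact absurd h3 (hc t₁ Γ)
    | bud Γ k =>
      obtain ⟨k', h7, -, h8⟩ := sub_stripped_bud hP h3
      rw [h4, h1] at h7
      cases h7
      obtain ⟨-, Q₂, hQ₂, -⟩ := hP.bud _ _ _ h3
      exact .jump h3 (ih _ _ hQ₂ (by rw [← h8, h4]))
    | infer R cs =>
      obtain ⟨r, hr⟩ := Option.ne_none_iff_exists'.1 (h5 R cs rfl)
      obtain ⟨-, cs'', h7⟩ := sub_stripped_infer hr h3
      rw [h4, h1] at h7
      cases h7

theorem coterm_stripped (hP : P.WellLabelled) (hc : P.assumptions = []) :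
    CGT.coterm (stripped P) = coterm P := by
  ext ⟨p, r⟩
  constructor
  · exact fun h => reads_of_stripped hP hc h [] P (Preproof.sub_nil P) (pos_nil P)
  · intro h
    have := reads_stripped hP h
    rwa [pos_nil] at this

end

end RGT

/-- König's lemma for finite nonempty sets in which every element has a predecessor. -/
theorem exists_seq_of_backward {α : Type*} {O : ℕ → Set α} {E : ℕ → α → α → Prop}
    (hfin : ∀ n, (O n).Finite) (hne : ∀ n, (O n).Nonempty)
    (hE : ∀ n, ∀ y ∈ O (n + 1), ∃ x ∈ O n, E n x y) :
    ∃ x : ℕ → α, ∀ n, x n ∈ O n ∧ E n (x n) (x (n + 1)) := by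
  classical
  have : Nonempty α := (hne 0).to_subtype.map Subtype.val
  choose! p hpO hpE using hE
  choose z hz using hne
  -- `back k n y` is the ancestor at level `n` of an element `y` of level `n + k`.
  let back : ℕ → ℕ → α → α := fun k => Nat.rec (fun _ y => y) (fun _ ih n y => p n (ih (n + 1) y)) k
  have hback : ∀ k n y, y ∈ O (n + k) → back k n y ∈ O n := by
    intro k
    induction k with
    | zero => exact fun n y hy => hy
    | succ k ih =>
      intro n y hy
      exact hpO n _ (ih (n + 1) y (by rwa [Nat.add_right_comm]))
  -- Since `O n` is finite, the ancestor at level `n` of `z m` is the same for `U`-almost all `m`.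
  -- The ancestors so selected are compatible, because finitely many such conditions hold for a
  -- common `m`.
  let U : Ultrafilter ℕ := Filter.hyperfilter ℕ
  have hU : ∀ n, ∀ᶠ m in (U : Filter ℕ), n ≤ m := fun n =>
    Nat.hyperfilter_le_atTop (Filter.eventually_ge_atTop n)
  have hex : ∀ n, ∃ x ∈ O n, ∀ᶠ m in (U : Filter ℕ), back (m - n) n (z m) = x := by
    intro n
    rw [← Ultrafilter.eventually_exists_mem_iff (hfin n)]
    filter_upwards [hU n] with m hm
    exact ⟨_, hback (m - n) n (z m) (by rw [Nat.add_sub_cancel' hm]; exact hz m), rfl⟩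
  choose x hxO hx using hex
  refine ⟨x, fun n => ⟨hxO n, ?_⟩⟩
  obtain ⟨m, h1, h2, h3⟩ := ((hx n).and ((hx (n + 1)).and (hU (n + 1)))).exists
  have h4 : back (m - n) n (z m) = p n (back (m - (n + 1)) (n + 1) (z m)) := by
    rw [show m - n = m - (n + 1) + 1 by omega]
  rw [← h1, h4, h2]
  exact hpE n _ (hxO (n + 1))

namespace RGT

open TraceInterp

section

variable {P : Preproof deriv}

/-! ### Branches of the translation -/

/-- A step of a branch of `P`, together with the corresponding progress of the position on a branch of the
translation. -/
def Advance (P : Preproof deriv) (s t : List ℕ × ℕ) : Prop :=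
  (∃ R cs, P.sub s.1 = some (.infer R cs) ∧ R.1.erase = none ∧ t = (s.1 ++ [0], s.2)) ∨
  (∃ R cs r i, P.sub s.1 = some (.infer R cs) ∧ R.1.erase = some r ∧
    i < (deriv.prems R).length ∧ t = (s.1 ++ [i], s.2 + 1)) ∨
  ∃ Γ k, P.sub s.1 = some (.bud Γ k) ∧ t = (Preproof.companion s.1 k, s.2 + 1)

theorem Advance.step {s t : List ℕ × ℕ} (h : Advance P s t) : P.Step s.1 t.1 := by
  rcases h with ⟨R, cs, h, hr, rfl⟩ | ⟨R, cs, r, i, h, hr, hi, rfl⟩ | ⟨Γ, k, h, rfl⟩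
  · exact .inl ⟨R, cs, 0, h, by rw [length_prems_of_erase_none hr]; exact one_pos, rfl⟩
  · exact .inl ⟨R, cs, i, h, hi, rfl⟩
  · exact .inr ⟨Γ, k, h, rfl⟩

/-- A branch of the translation comes from a branch of the preproof. -/
theorem exists_branch (hP : P.WellLabelled) (hc : P.assumptions = []) {π : ℕ → List ℕ}
    (hπ : (stripped P).IsBranch π) :
    ∃ ρ : ℕ → List ℕ × ℕ, P.IsBranch (fun n => (ρ n).1) ∧ (∀ n, Advance P (ρ n) (ρ (n + 1))) ∧
      ∀ n, pos P (ρ n).1 = π (ρ n).2 := by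
  rw [Preproof.assumptions_eq_nil_iff] at hc
  -- A state is a node together with the time on `π` to which it corresponds; at a reset the node
  -- moves while the time stands still.
  let V := {s : List ℕ × ℕ // (∃ Q, P.sub s.1 = some Q) ∧ pos P s.1 = π s.2}
  have hnext : ∀ s : V, ∃ t : V, Advance P s.1 t.1 := by
    rintro ⟨⟨t, i⟩, ⟨Q, hQ⟩, hpos⟩
    simp only at hQ hpos
    suffices h : ∃ t', Advance P (t, i) t' ∧ pos P t'.1 = π t'.2 by
      obtain ⟨t', h1, h2⟩ := h
      exact ⟨⟨t', h1.step.exists_sub, h2⟩, h1⟩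
    cases Q with
    | hyp Γ => exact absurd hQ (hc t Γ)
    | bud Γ k =>
      obtain ⟨k', h1, -, h2⟩ := sub_stripped_bud hP hQ
      refine ⟨_, .inr (.inr ⟨Γ, k, hQ, rfl⟩), ?_⟩
      rw [hpos] at h1 h2
      rcases hπ.2 i with ⟨R, cs, j, h3, -⟩ | ⟨Γ', l, h3, h4⟩
      · rw [h1] at h3
        cases h3
      · rw [h1] at h3
        cases h3
        exact h2.symm.trans h4.symm
    | infer R cs =>
      rcases hr : R.1.erase with _ | r
      · refine ⟨_, .inl ⟨R, cs, hQ, hr, rfl⟩, ?_⟩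
        exact (pos_snoc_of_none hr hQ (by rw [length_prems_of_erase_none hr]; exact one_pos)).trans
          hpos
      · obtain ⟨hl, cs', h1⟩ := sub_stripped_infer hr hQ
        rw [hpos] at h1
        rcases hπ.2 i with ⟨R', cs'', j, h3, hj, h4⟩ | ⟨Γ', l, h3, h4⟩
        · rw [h1] at h3
          cases h3
          have hj' : j < (deriv.prems R).length := hl ▸ hj
          refine ⟨_, .inr (.inl ⟨R, cs, r, j, hQ, hr, hj', rfl⟩), ?_⟩
          exact (pos_snoc_of_some hr hQ hj').trans (by rw [hpos, h4])
        · rw [h1] at h3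
          cases h3
  choose next hnext using hnext
  let s₀ : V := ⟨([], 0), ⟨P, Preproof.sub_nil P⟩, by rw [pos_nil, hπ.1]⟩
  let ρ : ℕ → V := fun n => Nat.rec s₀ (fun _ s => next s) n
  exact ⟨fun n => (ρ n).1, ⟨rfl, fun n => (hnext (ρ n)).step⟩, fun n => hnext (ρ n),
    fun n => (ρ n).2.2⟩

/-! ### Traces -/

/-- One step of a trace through the occurrences carrying the letter `a`. -/
def TraceStep (T : TracePath Bool) (a : ℕ) (Γ Γ' : Ctx) (i i' : ℕ) (y y' : ℕ) : Prop :=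
  ∃ c v v', Ann Γ y v ∧ a ∈ v ∧ Ann Γ' y' v' ∧ a ∈ v' ∧ (c = false → v' <+: v) ∧
    ((i' = i ∧ y' = y ∧ c = false) ∨ (i' = i + 1 ∧ (y, c, y') ∈ T.step i))

/-- Read from the later node to the earlier one, an annotation containing `a` always has a source
containing `a`: as `a` is already in the earlier control, it is not the letter freshly introduced.
Without progress the annotation is kept, or truncated by a reset. -/
theorem exists_traceStep (hP : P.WellLabelled) {π : ℕ → List ℕ} {s t : List ℕ × ℕ} (h : Advance P s t)
    (hs : pos P s.1 = π s.2) (ht : pos P t.1 = π t.2) {Q Q' : Preproof deriv}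
    (hQ : P.sub s.1 = some Q) (hQ' : P.sub t.1 = some Q') {a : ℕ} (ha : a ∈ Q.endseq.1.ctrl)
    {y : ℕ} {v : List ℕ} (hv : Ann Q'.endseq.1.ctx y v) (hav : a ∈ v) :
    ∃ x, TraceStep (CGT.interp.path (stripped P) π) a Q.endseq.1.ctx Q'.endseq.1.ctx s.2 t.2 x y := by
  rcases h with ⟨R, cs, h, hr, rfl⟩ | ⟨R, cs, r, i, h, hr, hi, rfl⟩ | ⟨Γ, k, h, rfl⟩
  · rw [hQ] at h
    cases h
    have hi : 0 < (deriv.prems R).length := by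
      rw [length_prems_of_erase_none hr]; exact one_pos
    obtain rfl : Q' = cs ⟨0, hi⟩ :=
      Option.some.inj (hQ'.symm.trans (Preproof.sub_snoc.2 ⟨R, cs, hi, hQ, rfl⟩))
    rw [hP.child _ R cs hQ ⟨0, hi⟩] at hv ⊢
    refine ⟨y, false, ?_⟩
    obtain ⟨R, hR⟩ := R
    cases R with
    | reset Θ Γ u b us B =>
      obtain ⟨w, hw⟩ := (ann_prem_reset hR y).2 v hv
      have hv' := (ann_prem_reset hR y).1 w hw
      obtain rfl := hv.unique hv'
      have hpre : (if b ∈ w then u ++ [b] else w) <+: w := by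
        split_ifs with hb
        · obtain ⟨w', -, rfl⟩ := ann_concl_reset hR hw hb
          exact ⟨w', by simp⟩
        · exact List.prefix_rfl
      exact ⟨w, _, hw, hpre.subset hav, hv, hav, fun _ => hpre, .inl ⟨rfl, rfl, rfl⟩⟩
    | _ => cases hr
  · rw [hQ] at h
    cases h
    obtain rfl : Q' = cs ⟨i, hi⟩ :=
      Option.some.inj (hQ'.symm.trans (Preproof.sub_snoc.2 ⟨R, cs, hi, hQ, rfl⟩))
    rw [hP.child _ R cs hQ ⟨i, hi⟩] at hv ⊢
    have hi' : i < R.1.prems.length := by simpa [deriv] using hi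
    have hctx : ((deriv.prems R).get ⟨i, hi⟩).1 = R.1.prems[i] := by simp [deriv]
    rw [hctx] at hv ⊢
    have hT := R.2.transfer hr i hi'
    obtain ⟨hl, cs', hS⟩ := sub_stripped_infer hr hQ
    rw [hs] at hS
    have hstep : ∀ p, p ∈ CGT.traceMap r i → p ∈ (CGT.interp.path (stripped P) π).step s.2 := by
      intro p hp
      refine .inl ⟨r, cs', i, hS, ?_, hp⟩
      rw [← hs, ← ht]
      exact pos_snoc_of_some hr hQ hi
    obtain ⟨x, c, hxy⟩ := hT.pred y v hv (List.ne_nil_of_mem hav)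
    refine ⟨x, c, ?_⟩
    cases c
    · obtain ⟨w, hw, hw'⟩ := hT.same x y hxy
      obtain rfl := hv.unique hw'
      exact ⟨v, v, hw, hav, hv, hav, fun _ => List.prefix_rfl, .inr ⟨rfl, hstep _ hxy⟩⟩
    · obtain ⟨w, b, hb, -, -, hw, hw'⟩ := hT.progress x y hxy
      obtain rfl := hv.unique hw'
      have haw : a ∈ w := by
        rcases List.mem_append.1 hav with h | h
        · exact h
        · rw [List.mem_singleton.1 h] at ha
          exact absurd ha hb
      exact ⟨w, _, hw, haw, hv, hav, fun h => absurd h (by simp), .inr ⟨rfl, hstep _ hxy⟩⟩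
  · rw [hQ] at h
    cases h
    obtain ⟨-, Q₁, hQ₁, hΓ⟩ := hP.bud _ _ _ hQ
    obtain rfl := Option.some.inj (hQ'.symm.trans hQ₁)
    rw [hΓ] at hv ⊢
    obtain ⟨k', hS, -⟩ := sub_stripped_bud hP hQ
    rw [hs] at hS
    refine ⟨y, false, v, v, hv, hav, hv, hav, fun _ => List.prefix_rfl, .inr ⟨rfl, ?_⟩⟩
    exact .inr ⟨_, k', hS, hv.mem_Icc, rfl, rfl⟩

/-- The trace is chosen among the occurrences carrying a letter `a` that is reset infinitely often,
and it is sampled at the resets of `a`. -/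
theorem traceCondition_of_branch (hP : P.WellLabelled) (hc : P.assumptions = [])
    (hI : P.HasInvariants (D := deriv) (fun s => s.1.ctrl) (fun R => R.1.letter))
    {π : ℕ → List ℕ} (hπ : (stripped P).IsBranch π) :
    (CGT.interp.path (stripped P) π).TraceCondition := by
  obtain ⟨ρ, hρ, hadv, hpos⟩ := exists_branch hP hc hπ
  obtain ⟨N, a, hctrl, hreset⟩ := hI.exists_letter hρ
  choose Q hQ using fun n => hρ.exists_sub n
  set T := CGT.interp.path (stripped P) π with hT
  let Γ : ℕ → Ctx := fun n => (Q n).endseq.1.ctx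
  -- at a reset of `a`, the letter is not at the end of an annotation below, but it is above
  have hres : ∀ n R cs, P.sub (ρ n).1 = some (.infer R cs) → R.1.letter = some a →
      (∃ y v, Ann (Γ n) y v ∧ a ∈ v) ∧ (ρ (n + 1)).2 = (ρ n).2 ∧
      (∀ y v, Ann (Γ n) y v → a ∈ v → ∀ u, a ∉ u → v ≠ u ++ [a]) ∧
      ∀ y v, Ann (Γ (n + 1)) y v → a ∈ v → ∃ u, a ∉ u ∧ v = u ++ [a] := by
    intro n R cs h hR
    have hr : R.1.erase = none := by
      obtain ⟨R, hR'⟩ := R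
      cases R <;> first | rfl | cases hR
    have hi : 0 < (deriv.prems R).length := by
      rw [length_prems_of_erase_none hr]; exact one_pos
    have hQn : Q n = .infer R cs := Option.some.inj ((hQ n).symm.trans h)
    have hnext : ρ (n + 1) = ((ρ n).1 ++ [0], (ρ n).2) := by
      rcases hadv n with ⟨R', cs', h', -, h''⟩ | ⟨R', cs', r, i, h', hr', -, -⟩ | ⟨_, k, h', -⟩
      · exact h''
      · rw [h] at h'
        cases h'
        rw [hr] at hr'
        cases hr'
      · rw [h] at h'
        cases h'
    have hQn' : Q (n + 1) = cs ⟨0, hi⟩ := by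
      refine Option.some.inj ((hQ (n + 1)).symm.trans ?_)
      rw [hnext]
      exact Preproof.sub_snoc.2 ⟨R, cs, hi, h, rfl⟩
    have hΓ : Γ n = R.1.concl.ctx := by simp only [Γ, hQn]; rfl
    have hΓ' : Γ (n + 1) = ((deriv.prems R).get ⟨0, hi⟩).1.ctx := by
      simp only [Γ, hQn']
      rw [hP.child _ R cs h ⟨0, hi⟩]
    rw [hΓ, hΓ', hnext]
    obtain ⟨R, hR'⟩ := R
    cases R with
    | reset Θ Δ u b us B =>
      cases hR
      have hcw := hR'.concl_wf
      have hau : ∀ y w, Ann (RawRule.reset Θ Δ u a us B).concl.ctx y (u ++ a :: w) →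
          a ∉ u ∧ a ∉ w := by
        intro y w hw
        have := (hcw.ann_sublist hw).nodup hcw.nodup
        rw [List.nodup_append, List.nodup_cons] at this
        exact ⟨fun h => this.2.2 a h a (by simp) rfl, this.2.1.1⟩
      refine ⟨?_, rfl, ?_, ?_⟩
      · obtain ⟨w, hw⟩ := List.exists_mem_of_ne_nil us hR'.side.1
        obtain ⟨y, v, hv, hav⟩ := hcw.exists_ann (γ := a)
          ⟨(.N, u ++ a :: w), List.mem_append_right _ (List.mem_map.2 ⟨w, hw, rfl⟩), by simp⟩
        exact ⟨y, v, hv, hav⟩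
      · intro y v hv hav u' hu' he
        obtain ⟨w, hw, rfl⟩ := ann_concl_reset hR' hv hav
        -- The last letter is the last one of the nonempty `w`; it is not `a`, because annotations
        -- have no repetitions.
        have h1 : (u ++ a :: w).getLast? = some a := by rw [he]; simp
        have h2 := hau y w hv
        rw [List.getLast?_append_of_ne_nil _ (by simp)] at h1
        rw [List.getLast?_cons] at h1
        rcases List.eq_nil_or_concat w with rfl | ⟨w', b, rfl⟩
        · exact hR'.side.2.1 _ hw rfl
        · simp at h1
          simp [h1] at h2
      · intro y v hv hav
        obtain ⟨w, hw⟩ := (ann_prem_reset hR' y).2 v hv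
        have hv' := (ann_prem_reset hR' y).1 w hw
        obtain rfl := hv.unique hv'
        have haw : a ∈ w := by
          by_contra haw
          rw [if_neg haw] at hav
          exact haw hav
        obtain ⟨w', -, rfl⟩ := ann_concl_reset hR' hw haw
        exact ⟨u, (hau y w' hw).1, if_pos haw⟩
    | _ => cases hR
  have hback : ∀ n, N ≤ n → ∀ y v, Ann (Γ (n + 1)) y v → a ∈ v →
      ∃ x, TraceStep T a (Γ n) (Γ (n + 1)) (ρ n).2 (ρ (n + 1)).2 x y := fun n hn y v hv hav =>
    exists_traceStep hP (hadv n) (hpos n) (hpos (n + 1)) (hQ n) (hQ (n + 1))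
      (hctrl n (Q n) hn (hQ n)) hv hav
  -- The letter occurs at some later reset of `a`, and occurrences propagate backwards.
  have hocc : ∀ n, N ≤ n → ∃ y v, Ann (Γ n) y v ∧ a ∈ v := by
    intro n hn
    obtain ⟨m, R, cs, hm, h1, h2⟩ := hreset n
    have h3 := (hres m R cs h1 h2).1
    obtain ⟨k, rfl⟩ := Nat.exists_eq_add_of_le hm
    clear hm h1
    induction k with
    | zero => exact h3
    | succ k ih =>
      obtain ⟨y, v, hv, hav⟩ := h3
      obtain ⟨x, c, w, w', hw, haw, -⟩ := hback (n + k) (by omega) y v hv hav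
      exact ih ⟨x, w, hw, haw⟩
  obtain ⟨x, hx⟩ := exists_seq_of_backward
    (O := fun n => {y | ∃ v, Ann (Γ (N + n)) y v ∧ a ∈ v})
    (E := fun n => TraceStep T a (Γ (N + n)) (Γ (N + n + 1)) (ρ (N + n)).2 (ρ (N + n + 1)).2)
    (fun n => (Finset.finite_toSet (Finset.Icc 1 _)).subset fun y ⟨v, hv, _⟩ => hv.mem_Icc)
    (fun n => by
      obtain ⟨y, v, h⟩ := hocc (N + n) (by omega)
      exact ⟨y, v, h⟩)
    (fun n y ⟨v, hv, hav⟩ => by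
      obtain ⟨z, hz⟩ := hback (N + n) (by omega) y v hv hav
      obtain ⟨c, w, w', hw, haw, h⟩ := hz
      exact ⟨z, ⟨w, hw, haw⟩, c, w, w', hw, haw, h⟩)
  have hobj : ∀ n y v, Ann (Γ n) y v → y ∈ T.obj (ρ n).2 := by
    intro n y v hv
    obtain ⟨Q', h1, h2⟩ := exists_sub_stripped hP (hQ n)
    rw [hpos n] at h1
    simp only [hT, TraceInterp.path, h1, h2]
    exact hv.mem_Icc
  -- the composite of the trace steps
  have hhom : ∀ n v, Ann (Γ (N + n)) (x n) v → a ∈ v → ∀ k, ∃ c v' m,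
      (ρ (N + n + k)).2 = (ρ (N + n)).2 + m ∧
      Ann (Γ (N + n + k)) (x (n + k)) v' ∧ a ∈ v' ∧ (c = false → v' <+: v) ∧
      (x n, c, x (n + k)) ∈ T.hom (ρ (N + n)).2 m := by
    intro n v hv hav k
    induction k with
    | zero =>
      exact ⟨false, v, 0, rfl, hv, hav, fun _ => List.prefix_rfl, hobj _ _ _ hv, rfl, rfl⟩
    | succ k ih =>
      obtain ⟨c, v', m, h1, h2, h3, h4, h5⟩ := ih
      have hstep := (hx (n + k)).2
      rw [← Nat.add_assoc N n k] at hstep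
      obtain ⟨c', w, w', h6, h7, h8, h9, h10, h11⟩ := hstep
      obtain rfl := h2.unique h6
      rw [h1] at h11
      rcases h11 with ⟨h11, h12, rfl⟩ | ⟨h11, h12⟩
      · refine ⟨c, w', m, h11, h8, h9, fun hc => (h10 rfl).trans (h4 hc), ?_⟩
        rw [← Nat.add_assoc n k 1, h12]
        exact h5
      · refine ⟨c ⊔ c', w', m + 1, by rw [← Nat.add_assoc, h11, Nat.add_assoc], h8, h9, ?_,
          x (n + k), c, c', h5, h12, rfl⟩
        -- A composite has value `false` only if both parts do, and then the prefix relations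
        -- compose.
        cases c <;> cases c' <;> simp at h4 h10 ⊢
        exact h10.trans h4
  obtain ⟨φ, hφ, hφ'⟩ := Nat.exists_strictMono_subsequence
    (P := fun n => ∃ R cs, P.sub (ρ (N + n)).1 = some (.infer R cs) ∧ R.1.letter = some a)
    (fun M => by
      obtain ⟨n, R, cs, h1, h2, h3⟩ := hreset (N + M + 1)
      refine ⟨n - N, by omega, R, cs, ?_, h3⟩
      rw [Nat.add_sub_cancel' (by omega)]
      exact h2)
  -- Just after one reset of `a` the annotation is `u ++ [a]` with `a ∉ u`. Without progress the
  -- next reset of `a` would meet a prefix of it containing `a`, that is `u ++ [a]` itself, but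
  -- there `a` cannot be the last letter.
  have hmain : ∀ j, ∃ m, (ρ (N + φ (j + 1))).2 = (ρ (N + φ j)).2 + m ∧
      (x (φ j), true, x (φ (j + 1))) ∈ T.hom (ρ (N + φ j)).2 m := by
    intro j
    obtain ⟨R, cs, h1, h2⟩ := hφ' j
    obtain ⟨-, h3, -, h4⟩ := hres _ R cs h1 h2
    obtain ⟨R', cs', h1', h2'⟩ := hφ' (j + 1)
    obtain ⟨-, -, h5, -⟩ := hres _ R' cs' h1' h2'
    obtain ⟨c, w, w', -, -, h6, h7, -, h8⟩ := (hx (φ j)).2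
    have h9 : x (φ j + 1) = x (φ j) := by
      rcases h8 with ⟨-, h8, -⟩ | ⟨h8, -⟩
      · exact h8
      · omega
    obtain ⟨k, hk⟩ := Nat.exists_eq_add_of_lt (hφ (Nat.lt_succ_self j))
    -- The composite starts one step after the reset, where the annotation ends in `a`; neither the
    -- time on `π` nor the occurrence has changed in that step.
    obtain ⟨c, v, m, h10, h11, h12, h13, h14⟩ := hhom (φ j + 1) w' h6 h7 k
    rw [show φ j + 1 + k = φ (j + 1) by rw [hk]; ring] at h11 h14
    rw [show N + (φ j + 1) + k = N + φ (j + 1) by rw [hk]; ring] at h10 h11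
    rw [← Nat.add_assoc, h3] at h10 h14
    rw [h9] at h14
    refine ⟨m, h10, ?_⟩
    cases c
    · exfalso
      obtain ⟨u, hu, rfl⟩ := h4 _ _ h6 h7
      rcases List.prefix_concat_iff.1 (h13 rfl) with h | h
      · exact h5 _ _ h11 h12 u hu h
      · exact hu (h.subset h12)
    · exact h14
  refine ⟨fun j => (ρ (N + φ j)).2, strictMono_nat_of_lt_succ fun j => ?_, fun j => x (φ j),
    fun j => ?_, fun j => ?_⟩
  · obtain ⟨m, h1, h2⟩ := hmain j
    rcases Nat.eq_zero_or_pos m with rfl | hm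
    -- For `m = 0` the composite is an identity, which has no progress.
    · exact absurd h2.2.1 (show ¬ (true = false) by simp)
    · omega
  · obtain ⟨v, hv, -⟩ := (hx (φ j)).1
    exact hobj _ _ _ hv
  · obtain ⟨m, h1, h2⟩ := hmain j
    simp only
    rw [h1, Nat.add_sub_cancel_left]
    exact h2

theorem stripped_mem_pfs (h : P ∈ sys.pfs) : stripped P ∈ CGT.sys.pfs := by
  obtain ⟨h1, h2, h3⟩ := h
  refine ⟨isPreproof_stripped h1 h2, ?_, ?_⟩
  · exact assumptions_stripped ((Preproof.isPreproof_iff P).1 h1) h2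
  · exact fun π hπ => traceCondition_of_branch ((Preproof.isPreproof_iff P).1 h1) h2 h3 hπ

end

end RGT

end CyclicGT

/-! ### The soundness theorem. -/

theorem mainTheorem7 :
    ∃ embed : CyclicGT.PreproofMorphism CyclicGT.RGT.deriv CyclicGT.CGT.interp.resetDeriv,
      (∀ s, embed.onSeq s = CyclicGT.RGT.embedSeq s) ∧
      (∀ R, CyclicGT.RGT.Corresponds R (embed.onRule R)) ∧
      CyclicGT.PreproofMorphism.IsProofMorphism
        (D := CyclicGT.RGT.sys) (E := CyclicGT.CGT.interp.resetSys) embed ∧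
      ∀ (Γ : List CyclicGT.Ty) (A : CyclicGT.Ty)
        (P : CyclicGT.Preproof CyclicGT.RGT.deriv),
        CyclicGT.RGT.IsProofOf P Γ A →
          CyclicGT.CGT.IsProofOf (CyclicGT.CGT.interp.strip.map (embed.map P)) Γ A ∧
          CyclicGT.CGT.coterm (CyclicGT.CGT.interp.strip.map (embed.map P)) =
            CyclicGT.RGT.coterm P := by
  refine ⟨CyclicGT.RGT.embed, fun _ => rfl, CyclicGT.RGT.corresponds_embedRule,
    CyclicGT.RGT.isProofMorphism_embed, ?_⟩
  rintro Γ A P ⟨hP, hend⟩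
  have hmap : CyclicGT.CGT.interp.strip.map (CyclicGT.RGT.embed.map P) =
      CyclicGT.RGT.stripped P := by
    rw [CyclicGT.RGT.map_embed hP.1]
    rfl
  have hW := (CyclicGT.Preproof.isPreproof_iff P).1 hP.1
  rw [hmap]
  refine ⟨⟨CyclicGT.RGT.stripped_mem_pfs hP, ?_⟩, CyclicGT.RGT.coterm_stripped hW hP.2.1⟩
  rw [CyclicGT.RGT.stripped, CyclicGT.RGT.endseq_stripAt hW.child, hend]
  simp [CyclicGT.RGT.embedSeq, CyclicGT.RGT.plain, Function.comp_def]
  rfl
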